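/- Let $n\ge 1$, and let $(K_1,d_{K_1}),\dots,(K_n,d_{K_n})$ be nonempty, complete, separable metric spaces of diameter at most one, each with a Borel probability measure $\lambda_i$ and a reference point $\ast_i\in K_i$. Let $f:\prod_i K_i\to\mathbb R$ be bounded and continuous, and let $\mu(d\mathbf x)=\frac1Z e^{f(\mathbf x)}\prod_i\lambda_i(dx_i)$ be its Gibbs measure, where $Z$ is the normalizing constant. For $\mathbf x,\mathbf y\in\prod_i K_i$ put $$\nabla f(\mathbf x,\mathbf y)=\sum_{i=1}^n\big[f(x_1,\dots,x_{i-1},y_i,x_{i+1},\dots,x_n)-f(x_1,\dots,x_{i-1},\ast_i,x_{i+1},\dots,x_n)\big].$$ A function on $\prod_i K_i$ is additively separable if it has the form $\mathbf x\mapsto\sum_i g_i(x_i)$ with each $g_i$ bounded and continuous on $K_i$; for such a function $g$ let $\xi_g$ be the product probability measure with density proportional to $e^{g}$ with respect to $\lambda_1\times\cdots\times\lambda_n$. Let $d_n(\mathbf x,\mathbf y)=\frac1n\sum_i d_{K_i}(x_i,y_i)$, and let $\overline{d_n}(\nu,\nu')$ be the infimum of $\int d_n\,d\pi$ over all couplings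 $\pi$ of the Borel probability measures $\nu$ and $\nu'$. Let $\mathrm D(\cdot\,\|\,\cdot)$ denote Kullback–Leibler divergence (with natural logarithm). Let $\varepsilon,\delta$ be real numbers, and suppose that the set $\{\nabla f(\mathbf x,\cdot):\mathbf x\in\prod_iK_i\}$ of bounded continuous functions can be covered by at most $e^{\varepsilon n}$ sets whose diameters in the uniform norm are less than $\delta n$. Then there are a partition $\mathcal P$ of $\prod_iK_i$ into at most $e^{\varepsilon n}$ Borel parts and additively separable functions $g_P$, $P\in\mathcal P$, such that $$\sum_{P\in\mathcal P}\mu(P)\,\mathrm D(\mu_{|P}\,\|\,\xi_{g_P})<(\varepsilon+\delta)n\qquad\text{and}\qquad\sum_{P\in\mathcal P}\mu(P)\,\overline{d_n}(\mu_{|P},\xi_{g_P})<\sqrt{(\varepsilon+\delta)/2},$$ where $\mu_{|P}=\mu(\,\cdot\mid P)$ is the conditioned measure, and parts with $\mu(P)=0$ contribute zero to both sums. -/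

import Mathlib

open MeasureTheory ProbabilityTheory InformationTheory BoundedContinuousFunction
open scoped ENNReal

namespace LowComplexityGibbs

/-- The Gibbs measure with density proportional to `exp f` with respect to the product of the
reference measures `lam i`. When `f` is additively separable this is the product measure
written `ξ_f`. -/
noncomputable def gibbs {n : ℕ} {K : Fin n → Type*} [∀ i, MeasurableSpace (K i)]
    (lam : ∀ i, Measure (K i)) (f : (∀ i, K i) → ℝ) : Measure (∀ i, K i) :=
  (Measure.pi lam).tilted f

/-- Functions of the form `x ↦ f₁(x₁) + ⋯ + fₙ(xₙ)` with each `fᵢ` bounded and continuous. -/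
def AdditivelySeparable {n : ℕ} {K : Fin n → Type*} [∀ i, TopologicalSpace (K i)]
    (g : (∀ i, K i) → ℝ) : Prop :=
  ∃ h : ∀ i, K i →ᵇ ℝ, ∀ x, g x = ∑ i, h i (x i)

/-- The discrete partial derivative `∂ᵢ f(x, y)` with respect to the reference points `star`. -/
def partialDiff {n : ℕ} {K : Fin n → Type*} (f : (∀ i, K i) → ℝ) (star : ∀ i, K i)
    (i : Fin n) (x : ∀ i, K i) (y : K i) : ℝ :=
  f (Function.update x i y) - f (Function.update x i (star i))

/-- The discrete gradient `∇f(x, ·)`, the function `y ↦ ∑ᵢ ∂ᵢ f(x, yᵢ)`, as an element of the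
space of bounded continuous functions with the uniform norm. -/
noncomputable def discreteGradient {n : ℕ} {K : Fin n → Type*} [∀ i, TopologicalSpace (K i)]
    (f : (∀ i, K i) →ᵇ ℝ) (star x : ∀ i, K i) : (∀ i, K i) →ᵇ ℝ :=
  BoundedContinuousFunction.ofNormedAddCommGroup
    (fun y => ∑ i, partialDiff f star i x (y i))
    (by
      refine continuous_finsetSum _ fun i _ => ?_
      exact (f.continuous.comp (continuous_const.update i (continuous_apply i))).sub
        continuous_const)
    (∑ _i : Fin n, (‖f‖ + ‖f‖))
    (fun y => (norm_sum_le _ _).trans <| Finset.sum_le_sum fun i _ =>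
      (norm_sub_le _ _).trans (add_le_add (f.norm_coe_le_norm _) (f.norm_coe_le_norm _)))

/-- The smallest cardinality of a covering of `A` by sets of diameter strictly less than `r`
(`⊤` if there is no finite covering). -/
noncomputable def covNumber {E : Type*} [PseudoMetricSpace E] (r : ℝ) (A : Set E) : ℕ∞ :=
  ⨅ (C : Set (Set E)) (_ : A ⊆ ⋃₀ C) (_ : ∀ S ∈ C, Metric.ediam S < ENNReal.ofReal r), C.encard

/-- The normalized Hamming average of the metrics of the factors. -/
noncomputable def hammingAvg {n : ℕ} {K : Fin n → Type*} [∀ i, MetricSpace (K i)]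
    (x y : ∀ i, K i) : ℝ :=
  (1 / (n : ℝ)) * ∑ i, dist (x i) (y i)

/-- The transportation metric over the normalized Hamming average: the infimum of
`∫ d_n(x, y) dπ(x, y)` over all couplings `π` of `μ` and `ν`. -/
noncomputable def transportDist {n : ℕ} {K : Fin n → Type*} [∀ i, MetricSpace (K i)]
    [∀ i, MeasurableSpace (K i)] (μ ν : Measure (∀ i, K i)) : ℝ≥0∞ :=
  ⨅ (π : Measure ((∀ i, K i) × (∀ i, K i))) (_ : π.fst = μ) (_ : π.snd = ν),
    ∫⁻ p, ENNReal.ofReal (hammingAvg p.1 p.2) ∂π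

end LowComplexityGibbs

/-!
The parts are obtained from a covering by pulling it back along `x ↦ ∇f(x, ·)`, passing to closures
and making the resulting sets disjoint (`exists_measurable_partition`). Within one part `P` the
gradients differ uniformly by at most some `D < δ n`, and `g_P` is the gradient `∇f(x_P, ·)` at a
point `x_P` of `P` whose normalizing constant is at most average in the logarithmic sense.

Divergence. Write `Λ` for the product of the reference measures, `μ` for the Gibbs measure of `f`,
and `Z_h = ∫ exp h dΛ`. Expanding the definition,
`∑ μ(P) D(μ_P ‖ ξ_{g_P}) = ∫ (f - log Z_f) dμ + H(P) - ∑ ∫_P (g_P - log Z_{g_P}) dμ`,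
where `H(P)` is the entropy of the partition, at most `ε n`. The first term is `D(μ ‖ Λ)`.
By subadditivity of entropy (`integral_mul_log_le_sum`) it is at most the sum of the conditional
divergences of the coordinates given all the others. The conditional law of the `i`-th coordinate
has density proportional to `exp (∂ᵢf(x, ·))`, so that sum equals
`∫ (∇f(x, x) - log Z_{∇f(x, ·)}) μ(dx)`. On `P` the choice of `x_P` controls the logarithms, and
replacing `∇f(x, x)` by `g_P(x)` costs at most `D`. Hence the total is at most `ε n + D`.

Transport. The measures `ξ_g` are product measures (`tilted_pi_sum`), so Marton's inequality
(`exists_coupling_le_sqrt`) bounds the transport distance on each part by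
`√(D(μ_P ‖ ξ_{g_P}) / 2n)`, and Jensen's inequality finishes. In the proof of Marton's inequality
the coordinates are decoupled one at a time, by an optimal coupling of conditional laws. The cost of
each step is the difference between the probability of some event and the mean of its conditional
probability given the other coordinates. The centred indicators of these events, scaled by a
parameter `t`, add up to a test function `F`: its integral against the density `ρ` is `t` times the
transport cost up to a term in `t ^ 2`, its exponential moment is bounded by Hoeffding's lemma one
coordinate at a time, and the variational inequality `∫ ρ F ≤ ∫ ρ log ρ - 1 + ∫ exp F` compares it
with the divergence. No disintegration of measures is needed, since all conditional expectations are
averages over single coordinates of bounded densities (`coordAvg`).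
-/

namespace LowComplexityGibbs

/-! ### Bounded measurable functions and averages over one coordinate -/

/-- Measurable real functions that are bounded everywhere, not merely almost everywhere, so that
averages over single coordinates are defined and bounded at every point. -/
def BddMeasurable {α : Type*} [MeasurableSpace α] (u : α → ℝ) : Prop :=
  Measurable u ∧ ∃ C, ∀ x, |u x| ≤ C

namespace BddMeasurable

variable {α β : Type*} [MeasurableSpace α] [MeasurableSpace β] {u v : α → ℝ}

lemma const (c : ℝ) : BddMeasurable fun _ : α => c :=
  ⟨measurable_const, |c|, fun _ => le_rfl⟩

lemma add (hu : BddMeasurable u) (hv : BddMeasurable v) : BddMeasurable fun x => u x + v x := by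
  obtain ⟨hu, C, hC⟩ := hu
  obtain ⟨hv, D, hD⟩ := hv
  exact ⟨hu.add hv, C + D, fun x => (abs_add_le _ _).trans (add_le_add (hC x) (hD x))⟩

lemma neg (hu : BddMeasurable u) : BddMeasurable fun x => -u x :=
  ⟨hu.1.neg, hu.2.choose, fun x => by simpa using hu.2.choose_spec x⟩

lemma sub (hu : BddMeasurable u) (hv : BddMeasurable v) : BddMeasurable fun x => u x - v x := by
  simpa only [sub_eq_add_neg] using hu.add hv.neg

lemma mul (hu : BddMeasurable u) (hv : BddMeasurable v) : BddMeasurable fun x => u x * v x := by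
  obtain ⟨hu, C, hC⟩ := hu
  obtain ⟨hv, D, hD⟩ := hv
  refine ⟨hu.mul hv, C * D, fun x => ?_⟩
  rw [abs_mul]
  exact mul_le_mul (hC x) (hD x) (abs_nonneg _) ((abs_nonneg _).trans (hC x))

lemma sum {ι : Type*} (s : Finset ι) {w : ι → α → ℝ} (hw : ∀ i ∈ s, BddMeasurable (w i)) :
    BddMeasurable fun x => ∑ i ∈ s, w i x := by
  classical
  induction s using Finset.induction_on with
  | empty => simpa using const 0
  | insert i s hi ih =>
    simp only [Finset.sum_insert hi]
    exact (hw i (by simp)).add (ih fun j hj => hw j (by simp [hj]))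

lemma comp (hu : BddMeasurable u) {g : β → α} (hg : Measurable g) :
    BddMeasurable fun x => u (g x) :=
  ⟨hu.1.comp hg, hu.2.choose, fun x => hu.2.choose_spec (g x)⟩

/-- Continuous functions of a bounded measurable function are bounded measurable. -/
lemma continuous_comp (hu : BddMeasurable u) {g : ℝ → ℝ} (hg : Continuous g) :
    BddMeasurable fun x => g (u x) := by
  obtain ⟨hu, C, hC⟩ := hu
  obtain ⟨B, hB⟩ := (isCompact_Icc (a := -C) (b := C)).exists_bound_of_continuousOn
    hg.continuousOn
  exact ⟨hg.measurable.comp hu, B, fun x => hB _ (abs_le.1 (hC x))⟩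

lemma exp (hu : BddMeasurable u) : BddMeasurable fun x => Real.exp (u x) :=
  hu.continuous_comp Real.continuous_exp

lemma mul_log (hu : BddMeasurable u) : BddMeasurable fun x => u x * Real.log (u x) :=
  hu.continuous_comp Real.continuous_mul_log

lemma indicator {s : Set α} (hs : MeasurableSet s) (hu : BddMeasurable u) :
    BddMeasurable (s.indicator u) := by
  obtain ⟨hu, C, hC⟩ := hu
  refine ⟨hu.indicator hs, C, fun x => ?_⟩
  by_cases hx : x ∈ s
  · simpa [hx] using hC x
  · simpa [hx] using (abs_nonneg _).trans (hC x)

lemma integrable (hu : BddMeasurable u) (m : Measure α) [IsFiniteMeasure m] : Integrable u m :=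
  Integrable.of_bound hu.1.aestronglyMeasurable hu.2.choose
    (Filter.Eventually.of_forall hu.2.choose_spec)

lemma log (hu : BddMeasurable u) {c : ℝ} (hc : 0 < c) (h : ∀ x, c ≤ u x) :
    BddMeasurable fun x => Real.log (u x) := by
  obtain ⟨hu, C, hC⟩ := hu
  refine ⟨hu.log, max |Real.log c| |Real.log C|, fun x => ?_⟩
  exact abs_le_max_abs_abs (Real.log_le_log hc (h x))
    (Real.log_le_log (hc.trans_le (h x)) ((le_abs_self _).trans (hC x)))

lemma inv (hu : BddMeasurable u) {c : ℝ} (hc : 0 < c) (h : ∀ x, c ≤ u x) :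
    BddMeasurable fun x => (u x)⁻¹ := by
  refine ⟨hu.1.inv, c⁻¹, fun x => ?_⟩
  rw [abs_of_pos (inv_pos.2 (hc.trans_le (h x)))]
  exact inv_anti₀ hc (h x)

end BddMeasurable

section ConstInCoord

variable {ι : Type*} [DecidableEq ι] {X : ι → Type*} {u v : (∀ i, X i) → ℝ} {i : ι}

/-- The function `u` does not depend on the `i`-th coordinate. -/
def ConstInCoord (i : ι) (u : (∀ i, X i) → ℝ) : Prop :=
  ∀ x y, u (Function.update x i y) = u x

lemma ConstInCoord.add (hu : ConstInCoord i u) (hv : ConstInCoord i v) :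
    ConstInCoord i fun x => u x + v x := fun x y => by simp only [hu x y, hv x y]

lemma ConstInCoord.sub (hu : ConstInCoord i u) (hv : ConstInCoord i v) :
    ConstInCoord i fun x => u x - v x := fun x y => by simp only [hu x y, hv x y]

lemma ConstInCoord.mul (hu : ConstInCoord i u) (hv : ConstInCoord i v) :
    ConstInCoord i fun x => u x * v x := fun x y => by simp only [hu x y, hv x y]

lemma ConstInCoord.comp (hu : ConstInCoord i u) (g : ℝ → ℝ) :
    ConstInCoord i fun x => g (u x) := fun x y => by simp only [hu x y]

/-- A function that depends on no coordinate at all is constant. -/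
lemma eq_of_forall_constInCoord [Fintype ι] (h : ∀ i, ConstInCoord i u) (x y : ∀ i, X i) :
    u x = u y := by
  have key : ∀ s : Finset ι, u (fun i => if i ∈ s then y i else x i) = u x := by
    intro s
    induction s using Finset.induction_on with
    | empty => simp
    | insert i s hi ih =>
      rw [← ih, ← h i (fun i => if i ∈ s then y i else x i) (y i)]
      congr 1
      ext j
      by_cases hj : j = i
      · subst hj
        simp
      · simp [hj]
  simpa using (key Finset.univ).symm

end ConstInCoord

section CoordAvg

variable {ι : Type*} [DecidableEq ι] {X : ι → Type*} [∀ i, MeasurableSpace (X i)]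

/-- The average of `u` over the `i`-th coordinate, the other coordinates being held fixed. It is
the conditional expectation of `u` given the other coordinates, under the product measure. -/
noncomputable def coordAvg (μ : ∀ i, Measure (X i)) (i : ι) (u : (∀ i, X i) → ℝ)
    (x : ∀ i, X i) : ℝ :=
  ∫ y, u (Function.update x i y) ∂μ i

variable {μ : ∀ i, Measure (X i)} {u v w : (∀ i, X i) → ℝ} {i j : ι}

/-- Resampling one coordinate leaves a product measure invariant. -/
lemma measurePreserving_update [Fintype ι] (μ : ∀ i, Measure (X i))
    [∀ i, IsProbabilityMeasure (μ i)] (i : ι) :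
    MeasurePreserving (fun p : (∀ i, X i) × X i => Function.update p.1 i p.2)
      ((Measure.pi μ).prod (μ i)) (Measure.pi μ) := by
  refine ⟨measurable_update', (Measure.pi_eq fun s hs => ?_).symm⟩
  have hpre : (fun p : (∀ i, X i) × X i => Function.update p.1 i p.2) ⁻¹' Set.univ.pi s
      = (Set.univ.pi (Function.update s i Set.univ)) ×ˢ s i := by
    ext p
    simp only [Set.mem_preimage, Set.mem_univ_pi, Set.mem_prod]
    constructor
    · intro h
      refine ⟨fun j => ?_, by simpa using h i⟩
      by_cases hj : j = i
      · subst hj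
        simp
      · simpa [hj] using h j
    · rintro ⟨h, hi⟩ j
      by_cases hj : j = i
      · subst hj
        simpa using hi
      · simpa [hj] using h j
  rw [Measure.map_apply measurable_update' (MeasurableSet.univ_pi hs), hpre,
    Measure.prod_prod, Measure.pi_pi, ← Finset.prod_erase_mul _ _ (Finset.mem_univ i),
    ← Finset.prod_erase_mul (Finset.univ) (fun j => μ j (s j)) (Finset.mem_univ i)]
  congr 1
  rw [Function.update_self, measure_univ, mul_one]
  refine Finset.prod_congr rfl fun j hj => ?_
  rw [Function.update_of_ne (Finset.ne_of_mem_erase hj)]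

lemma constInCoord_coordAvg (u : (∀ i, X i) → ℝ) : ConstInCoord i (coordAvg μ i u) := by
  intro x y
  simp [coordAvg]

lemma ConstInCoord.coordAvg (h : ConstInCoord j u) :
    ConstInCoord j (LowComplexityGibbs.coordAvg μ i u) := by
  by_cases hij : j = i
  · subst hij
    exact constInCoord_coordAvg u
  · intro x y
    simp only [LowComplexityGibbs.coordAvg]
    congr 1
    ext z
    rw [Function.update_comm hij, h]

lemma coordAvg_mul_of_constInCoord (hw : ConstInCoord i w) (u : (∀ i, X i) → ℝ) (x : ∀ i, X i) :
    coordAvg μ i (fun x => u x * w x) x = coordAvg μ i u x * w x := by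
  simp only [coordAvg, hw x]
  exact integral_mul_const _ _

variable [∀ i, IsProbabilityMeasure (μ i)]

lemma BddMeasurable.coordAvg (hu : BddMeasurable u) (i : ι) :
    BddMeasurable (LowComplexityGibbs.coordAvg μ i u) := by
  obtain ⟨hm, C, hC⟩ := hu
  refine ⟨?_, C, fun x => ?_⟩
  · have : StronglyMeasurable fun p : (∀ i, X i) × X i => u (Function.update p.1 i p.2) :=
      (hm.comp measurable_update').stronglyMeasurable
    exact this.integral_prod_right.measurable
  · have := norm_integral_le_of_norm_le_const (μ := μ i) (C := C)
      (f := fun y => u (Function.update x i y)) (Filter.Eventually.of_forall fun y => hC _)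
    simpa [LowComplexityGibbs.coordAvg] using this

lemma BddMeasurable.integrable_update (hu : BddMeasurable u) (x : ∀ i, X i) :
    Integrable (fun y => u (Function.update x i y)) (μ i) :=
  (hu.comp (measurable_update x)).integrable _

lemma coordAvg_mono (hu : BddMeasurable u) (hv : BddMeasurable v) (h : ∀ x, u x ≤ v x)
    (x : ∀ i, X i) : coordAvg μ i u x ≤ coordAvg μ i v x :=
  integral_mono (hu.integrable_update x) (hv.integrable_update x) fun _ => h _

lemma coordAvg_const (c : ℝ) (x : ∀ i, X i) : coordAvg μ i (fun _ => c) x = c := by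
  simp [coordAvg]

lemma le_coordAvg (hu : BddMeasurable u) {c : ℝ} (h : ∀ x, c ≤ u x) (x : ∀ i, X i) :
    c ≤ coordAvg μ i u x :=
  (coordAvg_const (μ := μ) c x).symm.le.trans
    (coordAvg_mono (.const c) hu h x)

variable [Fintype ι]

lemma integral_coordAvg (hu : BddMeasurable u) (i : ι) :
    ∫ x, coordAvg μ i u x ∂Measure.pi μ = ∫ x, u x ∂Measure.pi μ := by
  have hp := measurePreserving_update μ i
  have hi : Integrable (fun p : (∀ i, X i) × X i => u (Function.update p.1 i p.2))
      ((Measure.pi μ).prod (μ i)) := (hu.comp measurable_update').integrable _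
  rw [← hp.map_eq, integral_map hp.measurable.aemeasurable hu.1.aestronglyMeasurable,
    integral_prod _ hi, hp.map_eq]
  rfl

/-- `coordAvg` is self-adjoint, tested against functions that do not depend on the averaged
coordinate. -/
lemma integral_coordAvg_mul (hu : BddMeasurable u) (hw : BddMeasurable w)
    (hwi : ConstInCoord i w) :
    ∫ x, coordAvg μ i u x * w x ∂Measure.pi μ = ∫ x, u x * w x ∂Measure.pi μ := by
  rw [← integral_coordAvg (hu.mul hw) i]
  simp only [coordAvg_mul_of_constInCoord hwi]

end CoordAvg

/-! ### Subadditivity of entropy -/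

section Entropy

variable {ι : Type*} [DecidableEq ι] [Fintype ι] {X : ι → Type*} [∀ i, MeasurableSpace (X i)]
  {μ : ∀ i, Measure (X i)} [∀ i, IsProbabilityMeasure (μ i)] {φ u : (∀ i, X i) → ℝ}

/-- Gibbs' inequality along one coordinate: with `E_i` for the average over the `i`-th coordinate,
the integral `∫ φ log (u / E_i u)` is maximal when the conditional density `u / E_i u` is that of
`φ` itself. -/
lemma integral_mul_log_div_coordAvg_le (hφ : BddMeasurable φ) {c : ℝ} (hc : 0 < c)
    (hcφ : ∀ x, c ≤ φ x) (hu : BddMeasurable u) {d : ℝ} (hd : 0 < d) (hdu : ∀ x, d ≤ u x)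
    (i : ι) :
    ∫ x, φ x * (Real.log (u x) - Real.log (coordAvg μ i u x)) ∂Measure.pi μ
      ≤ ∫ x, φ x * (Real.log (φ x) - Real.log (coordAvg μ i φ x)) ∂Measure.pi μ := by
  have hEφ := hφ.coordAvg (μ := μ) i
  have hEu := hu.coordAvg (μ := μ) i
  have hcE := le_coordAvg (μ := μ) (i := i) hφ hcφ
  have hdE := le_coordAvg (μ := μ) (i := i) hu hdu
  have hw : BddMeasurable fun x => coordAvg μ i φ x * (coordAvg μ i u x)⁻¹ :=
    hEφ.mul (hEu.inv hd hdE)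
  have hwi : ConstInCoord i fun x => coordAvg μ i φ x * (coordAvg μ i u x)⁻¹ :=
    (constInCoord_coordAvg φ).mul ((constInCoord_coordAvg u).comp _)
  have h1 := hφ.mul ((hu.log hd hdu).sub (hEu.log hd hdE))
  have h2 := hφ.mul ((hφ.log hc hcφ).sub (hEφ.log hc hcE))
  have h3 : ∫ x, u x * (coordAvg μ i φ x * (coordAvg μ i u x)⁻¹) ∂Measure.pi μ
      = ∫ x, φ x ∂Measure.pi μ := by
    rw [← integral_coordAvg_mul hu hw hwi, ← integral_coordAvg hφ i]
    congr 1
    ext x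
    have := (hd.trans_le (hdE x)).ne'
    field_simp
  rw [← sub_nonpos, ← integral_sub (h1.integrable _) (h2.integrable _)]
  calc _ ≤ ∫ x, (u x * (coordAvg μ i φ x * (coordAvg μ i u x)⁻¹) - φ x) ∂Measure.pi μ := by
        refine integral_mono ((h1.sub h2).integrable _) (((hu.mul hw).sub hφ).integrable _)
          fun x => ?_
        have p1 := hc.trans_le (hcφ x)
        have p2 := hd.trans_le (hdu x)
        have p3 := hc.trans_le (hcE x)
        have p4 := hd.trans_le (hdE x)
        have p5 : 0 < u x * (coordAvg μ i φ x * (coordAvg μ i u x)⁻¹) / φ x := by positivity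
        have hl := Real.log_le_sub_one_of_pos p5
        rw [Real.log_div (by positivity) p1.ne', Real.log_mul p2.ne' (by positivity),
          Real.log_mul p3.ne' (by positivity), Real.log_inv] at hl
        have := mul_le_mul_of_nonneg_left hl p1.le
        rw [mul_sub, mul_sub (φ x) (_ / _), mul_div_cancel₀ _ p1.ne', mul_one] at this
        dsimp only
        linarith
    _ = 0 := by
        rw [integral_sub ((hu.mul hw).integrable _) (hφ.integrable _), h3, sub_self]

/-- Subadditivity of entropy under a product measure. Equivalently, the divergence of a measure
from a product measure is at most the sum of the conditional divergences of its coordinates, each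
given all the others. -/
theorem integral_mul_log_le_sum (hφ : BddMeasurable φ) {c : ℝ} (hc : 0 < c)
    (hcφ : ∀ x, c ≤ φ x) :
    ∫ x, φ x * (Real.log (φ x) - Real.log (∫ y, φ y ∂Measure.pi μ)) ∂Measure.pi μ
      ≤ ∑ i, ∫ x, φ x * (Real.log (φ x) - Real.log (coordAvg μ i φ x)) ∂Measure.pi μ := by
  -- `u` is `φ` averaged over the coordinates in `s`
  have key : ∀ s : Finset ι, ∃ u : (∀ i, X i) → ℝ, BddMeasurable u ∧ (∀ x, c ≤ u x) ∧
      (∀ i ∈ s, ConstInCoord i u) ∧ ∫ x, u x ∂Measure.pi μ = ∫ x, φ x ∂Measure.pi μ ∧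
      ∫ x, φ x * (Real.log (φ x) - Real.log (u x)) ∂Measure.pi μ
        ≤ ∑ i ∈ s, ∫ x, φ x * (Real.log (φ x) - Real.log (coordAvg μ i φ x)) ∂Measure.pi μ := by
    intro s
    induction s using Finset.induction_on with
    | empty => exact ⟨φ, hφ, hcφ, by simp, rfl, by simp⟩
    | insert i s hi ih =>
      obtain ⟨u, hu, hcu, hus, hint, hle⟩ := ih
      have hcE := le_coordAvg (μ := μ) (i := i) hu hcu
      refine ⟨coordAvg μ i u, hu.coordAvg i, hcE, ?_, by rw [integral_coordAvg hu i, hint], ?_⟩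
      · intro j hj
        rcases Finset.mem_insert.1 hj with rfl | hj
        · exact constInCoord_coordAvg u
        · exact (hus j hj).coordAvg
      · have h1 := hφ.mul ((hφ.log hc hcφ).sub (hu.log hc hcu))
        have h2 := hφ.mul ((hu.log hc hcu).sub ((hu.coordAvg (μ := μ) i).log hc hcE))
        have hsplit : ∫ x, φ x * (Real.log (φ x) - Real.log (coordAvg μ i u x)) ∂Measure.pi μ
            = ∫ x, φ x * (Real.log (u x) - Real.log (coordAvg μ i u x)) ∂Measure.pi μ
              + ∫ x, φ x * (Real.log (φ x) - Real.log (u x)) ∂Measure.pi μ := by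
          rw [← integral_add (h2.integrable _) (h1.integrable _)]
          congr 1
          ext x
          ring
        rw [hsplit, Finset.sum_insert hi]
        exact add_le_add (integral_mul_log_div_coordAvg_le hφ hc hcφ hu hc hcu i) hle
  obtain ⟨u, -, -, hus, hint, hle⟩ := key Finset.univ
  have hconst : ∀ x, u x = ∫ y, φ y ∂Measure.pi μ := fun x => by
    rw [← hint, integral_congr_ae (Filter.Eventually.of_forall fun y =>
      eq_of_forall_constInCoord (fun i => hus i (Finset.mem_univ i)) y x)]
    simp
  simpa only [hconst] using hle

end Entropy

/-! ### Couplings that move one coordinate -/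

/-- Integration against a density, in a form whose integrand is not a product of functions. -/
lemma lintegral_withDensity_mul {α : Type*} [MeasurableSpace α] (m : Measure α) {f g : α → ℝ≥0∞}
    (hf : Measurable f) (hg : Measurable g) :
    ∫⁻ x, g x ∂m.withDensity f = ∫⁻ x, f x * g x ∂m :=
  lintegral_withDensity_eq_lintegral_mul m hf hg

section Coupling

variable {ι : Type*} [DecidableEq ι] {X : ι → Type*} [∀ i, MeasurableSpace (X i)]
  {μ : ∀ i, Measure (X i)} [∀ i, IsProbabilityMeasure (μ i)]

lemma measurable_lintegral_update {G : (∀ i, X i) → ℝ≥0∞} (hG : Measurable G) (i : ι) :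
    Measurable fun x => ∫⁻ y, G (Function.update x i y) ∂μ i :=
  Measurable.lintegral_prod_right (f := fun x y => G (Function.update x i y))
    (hG.comp measurable_update')

variable [Fintype ι]

lemma lintegral_mul_lintegral_update {h G : (∀ i, X i) → ℝ≥0∞} (hh : Measurable h)
    (hG : Measurable G) {i : ι} (hi : ∀ x y, h (Function.update x i y) = h x) :
    ∫⁻ x, h x * ∫⁻ y, G (Function.update x i y) ∂μ i ∂Measure.pi μ
      = ∫⁻ x, h x * G x ∂Measure.pi μ := by
  have hp := measurePreserving_update μ i
  have hhG : Measurable fun x => h x * G x := hh.mul hG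
  rw [← hp.lintegral_comp hhG, lintegral_prod (fun p : (∀ i, X i) × X i =>
    h (Function.update p.1 i p.2) * G (Function.update p.1 i p.2))
    (hhG.comp hp.measurable).aemeasurable]
  refine lintegral_congr fun x => ?_
  simp only [hi]
  exact (lintegral_const_mul _ (hG.comp (measurable_update x))).symm

/-- Let `v` be the average of the density `u` over the `i`-th coordinate. A coupling whose second
marginal has density `u` can be turned into one whose second marginal has density `v` by moving
only the `i`-th coordinate of the second point, on an event of probability `∫ (u - v)⁺`. This is
the coupling of conditional laws that attains their total variation distance: the coordinate is
kept with probability `min 1 (v / u)`, and otherwise drawn with density proportional to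
`(v - u)⁺`. -/
lemma exists_coupling_lintegral_update {u : (∀ i, X i) → ℝ≥0∞} (hu : Measurable u)
    (hufin : ∀ x, u x ≠ ∞) (i : ι) {v : (∀ i, X i) → ℝ≥0∞}
    (hv : ∀ x, v x = ∫⁻ y, u (Function.update x i y) ∂μ i) (hvfin : ∀ x, v x ≠ ∞)
    (π : Measure ((∀ i, X i) × (∀ i, X i))) [SFinite π]
    (hπ : π.snd = (Measure.pi μ).withDensity u)
    {c : (∀ i, X i) × (∀ i, X i) → ℝ≥0∞} (hc : Measurable c)
    (hci : ∀ x z y, c (x, Function.update z i y) ≤ c (x, z) + 1) :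
    ∃ π' : Measure ((∀ i, X i) × (∀ i, X i)), SFinite π' ∧ π'.fst = π.fst ∧
      π'.snd = (Measure.pi μ).withDensity v ∧
      ∫⁻ p, c p ∂π' ≤ ∫⁻ p, c p ∂π + ∫⁻ x, (u x - v x) ∂Measure.pi μ := by
  have hvm : Measurable v := by
    rw [funext hv]
    exact measurable_lintegral_update hu i
  have huv : Measurable fun x => u x - v x := hu.sub hvm
  have hvu : Measurable fun x => v x - u x := hvm.sub hu
  have hvi : ∀ x y, v (Function.update x i y) = v x := fun x y => by simp [hv]
  -- `T` is both the conditional mass of `(v - u)⁺` and that of `(u - v)⁺`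
  set T : (∀ i, X i) → ℝ≥0∞ := fun x => ∫⁻ y, (v x - u (Function.update x i y)) ∂μ i with hT
  have hTm' : ∀ x, T x = ∫⁻ y, (fun x => v x - u x) (Function.update x i y) ∂μ i := fun x => by
    simp only [hT, hvi]
  have hTm : Measurable T := by
    rw [funext hTm']
    exact measurable_lintegral_update hvu i
  have hTi : ∀ x y, T (Function.update x i y) = T x := fun x y => by simp [hT, hvi]
  have hTfin : ∀ x, T x ≠ ∞ := fun x => by
    refine ne_top_of_le_ne_top (hvfin x) ?_
    calc T x ≤ ∫⁻ _, v x ∂μ i := lintegral_mono fun y => tsub_le_self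
      _ = v x := by simp
  have hS : ∀ x, ∫⁻ y, (u (Function.update x i y) - v x) ∂μ i = T x := fun x => by
    have hux : Measurable fun y => u (Function.update x i y) := hu.comp (measurable_update x)
    have h1 : ∫⁻ y, (u (Function.update x i y) - v x + v x) ∂μ i
        = ∫⁻ y, (v x - u (Function.update x i y) + u (Function.update x i y)) ∂μ i :=
      lintegral_congr fun y => by rw [tsub_add_eq_max, tsub_add_eq_max, max_comm]
    rw [lintegral_add_right _ measurable_const, lintegral_add_right _ hux, ← hv] at h1
    simp only [lintegral_const, measure_univ, mul_one] at h1
    exact (ENNReal.add_left_inj (hvfin x)).1 h1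
  -- `r` is the probability of moving the coordinate. Where `T` vanishes the conditional law is
  -- already correct and nothing moves, which also avoids normalizing the zero function `(v - u)⁺`.
  set r : (∀ i, X i) → ℝ≥0∞ := fun x => if T x = 0 then 0 else (u x - v x) / u x with hr
  have hrm : Measurable r :=
    Measurable.ite (measurableSet_eq_fun hTm measurable_const) measurable_const
      (huv.div hu)
  have hr1 : ∀ x, r x ≤ 1 := fun x => by
    simp only [hr]
    split_ifs
    · exact zero_le_one
    · exact ENNReal.div_le_of_le_mul (by simp)
  have hbT : ∀ x, r x / T x * T x = r x := fun x => by
    by_cases h : T x = 0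
    · simp [hr, h]
    · exact ENNReal.div_mul_cancel h (hTfin x)
  have hur' : ∀ x, T x ≠ 0 → u x * r x = u x - v x := fun x h => by
    simp only [hr, h, if_false]
    by_cases h0 : u x = 0
    · simp [h0]
    · exact ENNReal.mul_div_cancel h0 (hufin x)
  have hnull : ∀ᵐ x ∂Measure.pi μ, T x = 0 → u x - v x = 0 := by
    have hm : Measurable fun x => if T x = 0 then (1 : ℝ≥0∞) else 0 :=
      Measurable.ite (measurableSet_eq_fun hTm measurable_const) measurable_const measurable_const
    have hmuv : Measurable fun x => (if T x = 0 then (1 : ℝ≥0∞) else 0) * (u x - v x) := hm.mul huv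
    have h0 : ∫⁻ x, (if T x = 0 then (1 : ℝ≥0∞) else 0) * (u x - v x) ∂Measure.pi μ = 0 := by
      rw [← lintegral_mul_lintegral_update hm huv (i := i)
        (fun x y => by simp only [hTi])]
      simp only [hvi, hS]
      refine (lintegral_congr fun x => ?_).trans lintegral_zero
      split_ifs with h <;> simp [h]
    rw [lintegral_eq_zero_iff hmuv] at h0
    filter_upwards [h0] with x hx hTx
    simpa [hTx] using hx
  have hur : ∀ᵐ x ∂Measure.pi μ, u x * r x = u x - v x := by
    filter_upwards [hnull] with x hx
    by_cases h : T x = 0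
    · simp [hr, h, hx h]
    · exact hur' x h
  -- the moved part of the coupling is the image under `m` of a measure with density `k`; where
  -- `T` vanishes, `r / T` is `0 / 0 = 0` as it should be
  set m : ((∀ i, X i) × (∀ i, X i)) × X i → (∀ i, X i) × (∀ i, X i) :=
    fun q => (q.1.1, Function.update q.1.2 i q.2) with hm
  have hmm : Measurable m := (measurable_fst.comp measurable_fst).prodMk
    (measurable_update'.comp ((measurable_snd.comp measurable_fst).prodMk measurable_snd))
  set k : ((∀ i, X i) × (∀ i, X i)) × X i → ℝ≥0∞ :=
    fun q => r q.1.2 / T q.1.2 * (v q.1.2 - u (m q).2) with hk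
  have hkm : Measurable k := by
    have h2 : Measurable fun q : ((∀ i, X i) × (∀ i, X i)) × X i => q.1.2 :=
      measurable_snd.comp measurable_fst
    exact ((hrm.comp h2).div (hTm.comp h2)).mul
      ((hvm.comp h2).sub (hu.comp (measurable_snd.comp hmm)))
  have hr2 : Measurable fun p : (∀ i, X i) × (∀ i, X i) => 1 - r p.2 :=
    measurable_const.sub (hrm.comp measurable_snd)
  have hform : ∀ φ : (∀ i, X i) × (∀ i, X i) → ℝ≥0∞, Measurable φ →
      ∫⁻ p, φ p ∂(π.withDensity (fun p => 1 - r p.2)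
        + ((π.prod (μ i)).withDensity k).map m)
      = ∫⁻ p, (1 - r p.2) * φ p ∂π
        + ∫⁻ p, r p.2 / T p.2 * ∫⁻ y, (v p.2 - u (Function.update p.2 i y))
          * φ (p.1, Function.update p.2 i y) ∂μ i ∂π := by
    intro φ hφ
    have hφm : Measurable fun q => φ (m q) := hφ.comp hmm
    rw [lintegral_add_measure, lintegral_withDensity_mul _ hr2 hφ,
      lintegral_map hφ hmm, lintegral_withDensity_mul _ hkm hφm,
      lintegral_prod (fun q => k q * φ (m q)) (hkm.mul hφm).aemeasurable]
    congr 1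
    refine lintegral_congr fun p => ?_
    rw [← lintegral_const_mul]
    · refine lintegral_congr fun y => ?_
      simp only [hk, hm, mul_assoc]
    · have hup : Measurable fun y => Function.update p.2 i y := measurable_update p.2
      exact (measurable_const.sub (hu.comp hup)).mul
        (hφ.comp (measurable_const.prodMk hup))
  have hsnd : ∀ ψ : (∀ i, X i) → ℝ≥0∞, Measurable ψ →
      ∫⁻ p, ψ p.2 ∂π = ∫⁻ x, u x * ψ x ∂Measure.pi μ := fun ψ hψ => by
    rw [← lintegral_withDensity_mul _ hu hψ, ← hπ, Measure.snd,
      lintegral_map hψ measurable_snd]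
  refine ⟨π.withDensity (fun p => 1 - r p.2) + ((π.prod (μ i)).withDensity k).map m,
    inferInstance, ?_, ?_, ?_⟩
  · refine Measure.ext_of_lintegral _ fun φ hφ => ?_
    have hφ1 : Measurable fun p : (∀ i, X i) × (∀ i, X i) => φ p.1 := hφ.comp measurable_fst
    rw [Measure.fst, Measure.fst, lintegral_map hφ measurable_fst,
      lintegral_map hφ measurable_fst, hform _ hφ1,
      ← lintegral_add_left (f := fun p : (∀ i, X i) × (∀ i, X i) => (1 - r p.2) * φ p.1)
        (hr2.mul hφ1)]
    refine lintegral_congr fun p => ?_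
    have : ∫⁻ y, (v p.2 - u (Function.update p.2 i y)) * φ p.1 ∂μ i = T p.2 * φ p.1 :=
      lintegral_mul_const _ (measurable_const.sub (hu.comp (measurable_update p.2)))
    rw [this, ← mul_assoc, hbT, ← add_mul, tsub_add_cancel_of_le (hr1 _), one_mul]
  · refine Measure.ext_of_lintegral _ fun φ hφ => ?_
    -- the part that stays contributes `min u v` to the second marginal, the moved part `(v - u)⁺`
    set w : (∀ i, X i) → ℝ≥0∞ := fun x => ∫⁻ y, (v x - u (Function.update x i y))
      * φ (Function.update x i y) ∂μ i with hw
    have hw' : ∀ x, w x = ∫⁻ y, (fun x => (v x - u x) * φ x) (Function.update x i y) ∂μ i :=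
      fun x => by simp only [hw, hvi]
    have hwm : Measurable w := by
      rw [funext hw']
      exact measurable_lintegral_update (hvu.mul hφ) i
    have hw0 : ∀ x, T x / T x * w x = w x := fun x => by
      by_cases h : T x = 0
      · have hm' : Measurable fun y => v x - u (Function.update x i y) :=
          measurable_const.sub (hu.comp (measurable_update x))
        have h' := (lintegral_eq_zero_iff hm').1 h
        have : w x = 0 := by
          simp only [hw]
          rw [lintegral_congr_ae (g := fun _ => 0), lintegral_zero]
          filter_upwards [h'] with y hy
          simp only [Pi.zero_apply] at hy
          simp [hy]
        simp [this]
      · rw [ENNReal.div_self h (hTfin x), one_mul]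
    have hwT : Measurable fun x => w x / T x := hwm.div hTm
    have hvuφ : Measurable fun x => (v x - u x) * φ x := hvu.mul hφ
    have hφ2 : Measurable fun p : (∀ i, X i) × (∀ i, X i) => φ p.2 := hφ.comp measurable_snd
    have e2 : ∫⁻ x, u x * (r x / T x * w x) ∂Measure.pi μ
        = ∫⁻ x, (v x - u x) * φ x ∂Measure.pi μ := by
      calc _ = ∫⁻ x, w x / T x * (u x - v x) ∂Measure.pi μ := by
            refine lintegral_congr_ae ?_
            filter_upwards [hur] with x hx
            rw [← hx]
            simp only [div_eq_mul_inv]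
            ring
        -- `w / T` does not depend on the coordinate `i`, so `(u - v)⁺` may be averaged over it
        _ = ∫⁻ x, w x / T x * T x ∂Measure.pi μ := by
            rw [← lintegral_mul_lintegral_update hwT huv (i := i)
              (fun x y => by simp [hw, hvi, hTi])]
            simp only [hvi, hS]
        _ = ∫⁻ x, 1 * w x ∂Measure.pi μ := by
            refine lintegral_congr fun x => ?_
            nth_rw 2 [← hw0 x]
            simp only [div_eq_mul_inv]
            ring
        _ = _ := by
            simp only [hw']
            rw [lintegral_mul_lintegral_update measurable_const hvuφ
              (fun _ _ => rfl)]
            simp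
    rw [Measure.snd, lintegral_map hφ measurable_snd, hform _ hφ2,
      lintegral_withDensity_mul _ hvm hφ,
      hsnd (fun x => (1 - r x) * φ x) ((measurable_const.sub hrm).mul hφ),
      hsnd (fun x => r x / T x * w x) ((hrm.div hTm).mul hwm), e2,
      ← lintegral_add_right _ hvuφ]
    refine lintegral_congr_ae ?_
    filter_upwards [hur] with x hx
    rw [← mul_assoc, ENNReal.mul_sub (fun _ _ => hufin x), hx, mul_one, ← add_mul]
    congr 1
    rcases le_total (u x) (v x) with h | h
    · rw [tsub_eq_zero_of_le h, tsub_zero, add_tsub_cancel_of_le h]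
    · rw [tsub_eq_zero_of_le h, add_zero, ENNReal.sub_sub_cancel (hufin x) h]
  · have hcr : ∀ p : (∀ i, X i) × (∀ i, X i), ∫⁻ y, (v p.2 - u (Function.update p.2 i y))
        * c (p.1, Function.update p.2 i y) ∂μ i ≤ T p.2 * (c p + 1) := fun p => by
      calc _ ≤ ∫⁻ y, (v p.2 - u (Function.update p.2 i y)) * (c p + 1) ∂μ i :=
            lintegral_mono fun y => mul_le_mul_right (hci _ _ _) _
        _ = _ := lintegral_mul_const _
            (measurable_const.sub (hu.comp (measurable_update p.2)))
    rw [hform c hc]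
    calc _ ≤ ∫⁻ p, (1 - r p.2) * c p ∂π + ∫⁻ p, r p.2 * (c p + 1) ∂π := by
          refine add_le_add le_rfl (lintegral_mono fun p => ?_)
          calc _ ≤ r p.2 / T p.2 * (T p.2 * (c p + 1)) := mul_le_mul_right (hcr p) _
            _ = _ := by rw [← mul_assoc, hbT]
      _ = ∫⁻ p, c p ∂π + ∫⁻ p, r p.2 ∂π := by
          rw [← lintegral_add_left (f := fun p => (1 - r p.2) * c p) (hr2.mul hc),
            ← lintegral_add_left hc]
          refine lintegral_congr fun p => ?_
          rw [mul_add, mul_one, ← add_assoc, ← add_mul, tsub_add_cancel_of_le (hr1 _), one_mul]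
      _ = _ := by
          rw [hsnd r hrm, lintegral_congr_ae hur]

end Coupling

/-! ### The transportation inequality for product measures -/

/-- Young's inequality for the conjugate pair `ρ log ρ - ρ` and `exp F`. -/
lemma mul_le_mul_log_sub_add_exp {ρ : ℝ} (hρ : 0 ≤ ρ) (F : ℝ) :
    ρ * F ≤ ρ * Real.log ρ - ρ + Real.exp F := by
  rcases hρ.eq_or_lt with rfl | h
  · simpa using (Real.exp_pos F).le
  · have h1 := mul_le_mul_of_nonneg_left (Real.add_one_le_exp (F - Real.log ρ)) h.le
    rw [Real.exp_sub, Real.exp_log h, mul_div_cancel₀ _ h.ne'] at h1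
    linarith

section Transport

variable {ι : Type*} [DecidableEq ι] {X : ι → Type*} [∀ i, MeasurableSpace (X i)]
  {μ : ∀ i, Measure (X i)} [∀ i, IsProbabilityMeasure (μ i)]

/-- Hoeffding's lemma for the conditional law of an event given all coordinates but one. -/
lemma coordAvg_exp_indicator_le {A : Set (∀ i, X i)} (hA : MeasurableSet A) (i : ι) (t : ℝ)
    (x : ∀ i, X i) :
    coordAvg μ i (fun x => Real.exp (t * (A.indicator (fun _ => 1) x
      - coordAvg μ i (A.indicator fun _ => 1) x) - t ^ 2 / 8)) x ≤ 1 := by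
  have hm : AEMeasurable (fun y => A.indicator (fun _ => (1 : ℝ)) (Function.update x i y)) (μ i) :=
    ((measurable_const.indicator hA).comp (measurable_update x)).aemeasurable
  have hb : ∀ᵐ y ∂μ i, A.indicator (fun _ => (1 : ℝ)) (Function.update x i y)
      ∈ Set.Icc (0 : ℝ) 1 := Filter.Eventually.of_forall fun y => by
    by_cases h : Function.update x i y ∈ A <;> simp [h]
  have h := (hasSubgaussianMGF_of_mem_Icc hm hb).mgf_le t
  have hi : ∀ y, coordAvg μ i (A.indicator fun _ => (1 : ℝ)) (Function.update x i y)
      = coordAvg μ i (A.indicator fun _ => 1) x := fun y => constInCoord_coordAvg _ x y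
  have e : coordAvg μ i (fun x => Real.exp (t * (A.indicator (fun _ => 1) x
      - coordAvg μ i (A.indicator fun _ => 1) x) - t ^ 2 / 8)) x
      = mgf (fun y => A.indicator (fun _ => (1 : ℝ)) (Function.update x i y)
        - ∫ y, A.indicator (fun _ => (1 : ℝ)) (Function.update x i y) ∂μ i) (μ i) t
        * Real.exp (-(t ^ 2 / 8)) := by
    rw [mgf, ← integral_mul_const]
    change ∫ y, Real.exp (t * (A.indicator (fun _ => 1) (Function.update x i y)
      - coordAvg μ i (A.indicator fun _ => 1) (Function.update x i y)) - t ^ 2 / 8) ∂μ i = _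
    congr 1
    ext y
    rw [← Real.exp_add, hi, sub_eq_add_neg (t * _)]
    rfl
  rw [e]
  calc _ ≤ Real.exp (t ^ 2 / 8) * Real.exp (-(t ^ 2 / 8)) := by
        refine mul_le_mul_of_nonneg_right (h.trans (le_of_eq ?_)) (Real.exp_pos _).le
        congr 1
        simp
        ring
    _ = 1 := by rw [← Real.exp_add]; simp

variable [Fintype ι]

/-- The stages of the coupling, in which the coordinates in `s` have been made independent of each
other and of the rest: `u` is the density `ρ` averaged over the coordinates in `s`, `π` is a
coupling of the measures with densities `ρ` and `u`, and `τ` bounds its cost. The functions `F`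
test the divergence of `ρ` from below in terms of that same cost. -/
lemma exists_coupling_and_test {ρ : (∀ i, X i) → ℝ} (hρ : BddMeasurable ρ) (hρ0 : ∀ x, 0 ≤ ρ x)
    {c : (∀ i, X i) × (∀ i, X i) → ℝ≥0∞} (hc : Measurable c) (hc0 : ∀ x, c (x, x) = 0)
    (hci : ∀ i x z y, c (x, Function.update z i y) ≤ c (x, z) + 1) (s : Finset ι) :
    ∃ (u : (∀ i, X i) → ℝ) (π : Measure ((∀ i, X i) × (∀ i, X i))) (τ : ℝ),
      BddMeasurable u ∧ (∀ x, 0 ≤ u x) ∧ (∀ i ∈ s, ConstInCoord i u) ∧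
      (∀ w, BddMeasurable w → (∀ i ∈ s, ConstInCoord i w) →
        ∫ x, u x * w x ∂Measure.pi μ = ∫ x, ρ x * w x ∂Measure.pi μ) ∧
      SFinite π ∧ π.fst = (Measure.pi μ).withDensity (fun x => ENNReal.ofReal (ρ x)) ∧
      π.snd = (Measure.pi μ).withDensity (fun x => ENNReal.ofReal (u x)) ∧
      0 ≤ τ ∧ ∫⁻ p, c p ∂π ≤ ENNReal.ofReal τ ∧
      ∀ t : ℝ, ∃ F : (∀ i, X i) → ℝ, BddMeasurable F ∧
        t * τ - s.card * (t ^ 2 / 8) * ∫ x, ρ x ∂Measure.pi μ ≤ ∫ x, ρ x * F x ∂Measure.pi μ ∧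
        ∀ w, BddMeasurable w → (∀ x, 0 ≤ w x) → (∀ i ∈ s, ConstInCoord i w) →
          ∫ x, Real.exp (F x) * w x ∂Measure.pi μ ≤ ∫ x, w x ∂Measure.pi μ := by
  induction s using Finset.induction_on with
  | empty =>
    have hd : Measurable fun x : ∀ i, X i => (x, x) := measurable_id.prodMk measurable_id
    refine ⟨ρ, ((Measure.pi μ).withDensity (fun x => ENNReal.ofReal (ρ x))).map
      (fun x => (x, x)), 0, hρ, hρ0, by simp, fun w _ _ => rfl, inferInstance, ?_, ?_, le_rfl, ?_,
      fun t => ⟨fun _ => 0, .const 0, by simp, fun w _ _ _ => by simp⟩⟩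
    · rw [Measure.fst, Measure.map_map measurable_fst hd]
      exact Measure.map_id
    · rw [Measure.snd, Measure.map_map measurable_snd hd]
      exact Measure.map_id
    · rw [lintegral_map hc hd]
      simp [hc0]
  | insert i s hi ih =>
    obtain ⟨u, π, τ, hu, hu0, hus, huw, hsf, hfst, hsnd, hτ, hcost, htest⟩ := ih
    have hv := hu.coordAvg (μ := μ) i
    have hv0 : ∀ x, 0 ≤ coordAvg μ i u x := le_coordAvg hu hu0
    have hvs : ∀ j ∈ insert i s, ConstInCoord j (coordAvg μ i u) := fun j hj => by
      rcases Finset.mem_insert.1 hj with rfl | hj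
      · exact constInCoord_coordAvg u
      · exact (hus j hj).coordAvg
    obtain ⟨π', hsf', hfst', hsnd', hcost'⟩ := exists_coupling_lintegral_update (μ := μ)
      (u := fun x => ENNReal.ofReal (u x)) hu.1.ennreal_ofReal (fun _ => ENNReal.ofReal_ne_top) i
      (v := fun x => ENNReal.ofReal (coordAvg μ i u x))
      (fun x => ofReal_integral_eq_lintegral_ofReal (hu.integrable_update x)
        (Filter.Eventually.of_forall fun _ => hu0 _))
      (fun _ => ENNReal.ofReal_ne_top) π hsnd hc (hci i)
    -- `∫ (u - v)⁺` is the integral of `u - v` over the event `A`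
    set A : Set (∀ i, X i) := {x | coordAvg μ i u x < u x} with hA
    have hAm : MeasurableSet A := measurableSet_lt hv.1 hu.1
    have h1A : BddMeasurable (A.indicator fun _ => (1 : ℝ)) := (BddMeasurable.const 1).indicator hAm
    have hAs : ∀ j ∈ s, ConstInCoord j (A.indicator fun _ => (1 : ℝ)) := fun j hj x y => by
      simp only [Set.indicator_apply, hA, Set.mem_ofPred_eq, hus j hj x y,
        (hus j hj).coordAvg x y]
    set q : (∀ i, X i) → ℝ := coordAvg μ i (A.indicator fun _ => 1) with hq
    have hqm : BddMeasurable q := h1A.coordAvg i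
    have hqs : ∀ j ∈ insert i s, ConstInCoord j q := fun j hj => by
      rcases Finset.mem_insert.1 hj with rfl | hj
      · exact constInCoord_coordAvg _
      · exact (hAs j hj).coordAvg
    set σ : ℝ := ∫ x, u x * (A.indicator (fun _ => 1) x - q x) ∂Measure.pi μ with hσ
    have hσ' : σ = ∫ x, (u x - coordAvg μ i u x) * A.indicator (fun _ => 1) x ∂Measure.pi μ := by
      have e1 : ∫ x, u x * q x ∂Measure.pi μ
          = ∫ x, coordAvg μ i u x * A.indicator (fun _ => 1) x ∂Measure.pi μ := by
        rw [← integral_coordAvg_mul hu hqm (hqs i (by simp))]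
        simp only [mul_comm (coordAvg μ i u _)]
        exact integral_coordAvg_mul h1A hv (hvs i (by simp))
      simp only [hσ, mul_sub, sub_mul]
      rw [integral_sub ((hu.mul h1A).integrable _) ((hu.mul hqm).integrable _),
        integral_sub ((hu.mul h1A).integrable _) ((hv.mul h1A).integrable _), e1]
    have hpos : ∀ x, 0 ≤ (u x - coordAvg μ i u x) * A.indicator (fun _ => 1) x := fun x => by
      by_cases hx : x ∈ A
      · simpa [hx] using le_of_lt hx
      · simp [hx]
    have hσ0 : 0 ≤ σ := hσ' ▸ integral_nonneg hpos
    have hσ2 : ∫⁻ x, (ENNReal.ofReal (u x) - ENNReal.ofReal (coordAvg μ i u x)) ∂Measure.pi μ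
        = ENNReal.ofReal σ := by
      rw [hσ', ofReal_integral_eq_lintegral_ofReal (((hu.sub hv).mul h1A).integrable _)
        (Filter.Eventually.of_forall hpos)]
      refine lintegral_congr fun x => ?_
      rw [← ENNReal.ofReal_sub _ (hv0 x)]
      by_cases hx : x ∈ A
      · simp [hx]
      · have : u x - coordAvg μ i u x ≤ 0 := sub_nonpos.2 (not_lt.1 hx)
        simp [hx, ENNReal.ofReal_of_nonpos this]
    refine ⟨coordAvg μ i u, π', τ + σ, hv, hv0, hvs, ?_, hsf', hfst'.trans hfst, hsnd',
      add_nonneg hτ hσ0, ?_, fun t => ?_⟩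
    · intro w hw hws
      rw [integral_coordAvg_mul hu hw (hws i (by simp)),
        huw w hw fun j hj => hws j (Finset.mem_insert_of_mem hj)]
    · rw [ENNReal.ofReal_add hτ hσ0, ← hσ2]
      exact hcost'.trans (add_le_add hcost le_rfl)
    · obtain ⟨F, hF, hFρ, hFw⟩ := htest t
      set G : (∀ i, X i) → ℝ := fun x => t * (A.indicator (fun _ => 1) x - q x) - t ^ 2 / 8 with hG
      have hGm : BddMeasurable G := ((BddMeasurable.const t).mul (h1A.sub hqm)).sub (.const _)
      have hGs : ∀ j ∈ s, ConstInCoord j G := fun j hj =>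
        ((hAs j hj).sub (hqs j (Finset.mem_insert_of_mem hj))).comp fun a => t * a - t ^ 2 / 8
      refine ⟨fun x => F x + G x, hF.add hGm, ?_, ?_⟩
      · have e : ∫ x, ρ x * G x ∂Measure.pi μ = t * σ - t ^ 2 / 8 * ∫ x, ρ x ∂Measure.pi μ := by
          have h1 := huw (fun x => A.indicator (fun _ => 1) x - q x) (h1A.sub hqm) fun j hj =>
            (hAs j hj).sub (hqs j (Finset.mem_insert_of_mem hj))
          rw [hσ, h1, ← integral_const_mul, ← integral_const_mul,
            ← integral_sub (((hρ.mul (h1A.sub hqm)).integrable _).const_mul _)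
              ((hρ.integrable _).const_mul _)]
          congr 1
          ext x
          simp only [hG]
          ring
        simp only [mul_add]
        rw [integral_add ((hρ.mul hF).integrable _) ((hρ.mul hGm).integrable _), e,
          Finset.card_insert_of_notMem hi]
        push_cast
        linarith
      · intro w hw hw0 hws
        have hGw : BddMeasurable fun x => Real.exp (G x) * w x := hGm.exp.mul hw
        calc _ = ∫ x, Real.exp (F x) * (Real.exp (G x) * w x) ∂Measure.pi μ := by
              simp only [Real.exp_add, mul_assoc]
          _ ≤ ∫ x, Real.exp (G x) * w x ∂Measure.pi μ :=
              hFw _ hGw (fun x => mul_nonneg (Real.exp_pos _).le (hw0 x)) fun j hj =>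
                ((hGs j hj).comp Real.exp).mul (hws j (Finset.mem_insert_of_mem hj))
          _ = ∫ x, coordAvg μ i (fun x => Real.exp (G x)) x * w x ∂Measure.pi μ :=
              (integral_coordAvg_mul hGm.exp hw (hws i (by simp))).symm
          _ ≤ ∫ x, w x ∂Measure.pi μ := by
              refine integral_mono (((hGm.exp.coordAvg i).mul hw).integrable _) (hw.integrable _)
                fun x => ?_
              exact mul_le_of_le_one_left (hw0 x) (coordAvg_exp_indicator_le hAm i t x)

/-- Marton's transportation inequality. A probability measure with bounded density `ρ` relative to
a product measure on `N` coordinates has a coupling to it with cost at most `√(N D / 2)`, where `D`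
is its divergence, provided moving one coordinate changes the cost by at most one. -/
theorem exists_coupling_le_sqrt [Nonempty ι] {ρ : (∀ i, X i) → ℝ} (hρ : BddMeasurable ρ)
    (hρ0 : ∀ x, 0 ≤ ρ x) (hρ1 : ∫ x, ρ x ∂Measure.pi μ = 1)
    {c : (∀ i, X i) × (∀ i, X i) → ℝ≥0∞} (hc : Measurable c) (hc0 : ∀ x, c (x, x) = 0)
    (hci : ∀ i x z y, c (x, Function.update z i y) ≤ c (x, z) + 1) :
    ∃ π : Measure ((∀ i, X i) × (∀ i, X i)),
      π.fst = (Measure.pi μ).withDensity (fun x => ENNReal.ofReal (ρ x)) ∧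
      π.snd = Measure.pi μ ∧
      ∫⁻ p, c p ∂π ≤ ENNReal.ofReal
        (Real.sqrt (Fintype.card ι * (∫ x, ρ x * Real.log (ρ x) ∂Measure.pi μ) / 2)) := by
  obtain ⟨u, π, τ, hu, hu0, hus, huw, -, hfst, hsnd, hτ, hcost, htest⟩ :=
    exists_coupling_and_test (μ := μ) hρ hρ0 hc hc0 hci Finset.univ
  have hu1 : ∀ x, u x = 1 := fun x => by
    have h := huw (fun _ => 1) (.const 1) fun _ _ _ _ => rfl
    simp only [mul_one] at h
    rw [hρ1, integral_congr_ae (Filter.Eventually.of_forall fun y =>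
      eq_of_forall_constInCoord (fun i => hus i (Finset.mem_univ i)) y x)] at h
    simpa using h
  refine ⟨π, hfst, by simpa [hu1] using hsnd, hcost.trans (ENNReal.ofReal_le_ofReal ?_)⟩
  set D := ∫ x, ρ x * Real.log (ρ x) ∂Measure.pi μ with hD
  have hN : (0 : ℝ) < Fintype.card ι := Nat.cast_pos.2 Fintype.card_pos
  -- `t = 4 τ / N` maximizes the lower bound `t τ - N t ^ 2 / 8` on the divergence
  obtain ⟨F, hF, hFρ, hFw⟩ := htest (4 * τ / Fintype.card ι)
  have h1 := hFw (fun _ => 1) (.const 1) (fun _ => zero_le_one) fun _ _ _ _ => rfl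
  have h2 : ∫ x, ρ x * F x ∂Measure.pi μ
      ≤ ∫ x, (ρ x * Real.log (ρ x) - ρ x + Real.exp (F x)) ∂Measure.pi μ :=
    integral_mono ((hρ.mul hF).integrable _) (((hρ.mul_log.sub hρ).add hF.exp).integrable _)
      fun x => mul_le_mul_log_sub_add_exp (hρ0 x) _
  rw [integral_add ((hρ.mul_log.sub hρ).integrable _) (hF.exp.integrable _),
    integral_sub (hρ.mul_log.integrable _) (hρ.integrable _), hρ1] at h2
  simp only [mul_one, integral_const, probReal_univ, smul_eq_mul] at h1
  rw [hρ1, Finset.card_univ] at hFρ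
  have h3 : 2 * τ ^ 2 / Fintype.card ι ≤ D := by
    have e : 4 * τ / Fintype.card ι * τ
        - Fintype.card ι * ((4 * τ / Fintype.card ι) ^ 2 / 8) * 1
        = 2 * τ ^ 2 / (Fintype.card ι : ℝ) := by
      field_simp
      ring
    linarith
  rw [div_le_iff₀ hN] at h3
  exact Real.le_sqrt_of_sq_le (by linarith)

end Transport

/-! ### Divergence between exponentially tilted measures -/

section Divergence

variable {α : Type*} [MeasurableSpace α]

lemma klDiv_withDensity_ofReal (ξ : Measure α) [IsProbabilityMeasure ξ] {ρ : α → ℝ}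
    (hρ : BddMeasurable ρ) (hρ0 : ∀ x, 0 ≤ ρ x) (hρ1 : ∫ x, ρ x ∂ξ = 1) :
    klDiv (ξ.withDensity fun x => ENNReal.ofReal (ρ x)) ξ
      = ENNReal.ofReal (∫ x, ρ x * Real.log (ρ x) ∂ξ) := by
  have hm : BddMeasurable fun x => ρ x * Real.log (ρ x) + 1 - ρ x :=
    (hρ.mul_log.add (.const 1)).sub hρ
  have : IsFiniteMeasure (ξ.withDensity fun x => ENNReal.ofReal (ρ x)) :=
    isFiniteMeasure_withDensity_ofReal (hρ.integrable ξ).2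
  rw [klDiv_eq_lintegral_klFun_of_ac (withDensity_absolutelyContinuous _ _)]
  calc _ = ∫⁻ x, ENNReal.ofReal (ρ x * Real.log (ρ x) + 1 - ρ x) ∂ξ := by
        refine lintegral_congr_ae ?_
        filter_upwards [ξ.rnDeriv_withDensity hρ.1.ennreal_ofReal] with x hx
        rw [hx, ENNReal.toReal_ofReal (hρ0 x), klFun]
    _ = ENNReal.ofReal (∫ x, (ρ x * Real.log (ρ x) + 1 - ρ x) ∂ξ) := by
        refine (ofReal_integral_eq_lintegral_ofReal (hm.integrable ξ)
          (Filter.Eventually.of_forall fun x => ?_)).symm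
        exact klFun_nonneg (hρ0 x)
    _ = _ := by
        rw [integral_sub ((hρ.mul_log.add (.const 1)).integrable ξ) (hρ.integrable ξ),
          integral_add (hρ.mul_log.integrable ξ) (integrable_const _), hρ1]
        simp

variable {Λ : Measure α} [IsProbabilityMeasure Λ] {f g : α → ℝ}

lemma BddMeasurable.isProbabilityMeasure_tilted (hf : BddMeasurable f) :
    IsProbabilityMeasure (Λ.tilted f) :=
  MeasureTheory.isProbabilityMeasure_tilted (hf.exp.integrable Λ)

/-- The density of a conditioned Gibbs measure relative to another Gibbs measure. -/
lemma exists_density_cond_tilted (hf : BddMeasurable f) (hg : BddMeasurable g) {P : Set α}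
    (hP : MeasurableSet P) (hPpos : Λ.tilted f P ≠ 0) :
    ∃ ρ : α → ℝ, BddMeasurable ρ ∧ (∀ x, 0 ≤ ρ x) ∧ ∫ x, ρ x ∂Λ.tilted g = 1 ∧
      cond (Λ.tilted f) P = (Λ.tilted g).withDensity (fun x => ENNReal.ofReal (ρ x)) ∧
      (Λ.tilted f).real P * ∫ x, ρ x * Real.log (ρ x) ∂Λ.tilted g
        = ∫ x in P, (f x - Real.log (∫ y, Real.exp (f y) ∂Λ)) ∂Λ.tilted f
          + ∫ x in P, (Real.log (∫ y, Real.exp (g y) ∂Λ) - g x) ∂Λ.tilted f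
          + Real.negMulLog ((Λ.tilted f).real P) := by
  have := hf.isProbabilityMeasure_tilted (Λ := Λ)
  set m := (Λ.tilted f).real P with hm
  have hm0 : 0 < m := ENNReal.toReal_pos hPpos (measure_ne_top _ _)
  set Zf := ∫ y, Real.exp (f y) ∂Λ with hZf
  set Zg := ∫ y, Real.exp (g y) ∂Λ with hZg
  have hZf0 : 0 < Zf := integral_exp_pos (hf.exp.integrable Λ)
  have hZg0 : 0 < Zg := integral_exp_pos (hg.exp.integrable Λ)
  -- the logarithm of the density on `P`
  set k : α → ℝ := fun x => (f x - Real.log Zf) + (Real.log Zg - g x) - Real.log m with hk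
  have h1 : BddMeasurable fun x => f x - Real.log Zf := hf.sub (.const _)
  have h2 : BddMeasurable fun x => Real.log Zg - g x := (BddMeasurable.const _).sub hg
  have hkm : BddMeasurable k := (h1.add h2).sub (.const _)
  set ρ : α → ℝ := P.indicator fun x => Real.exp (k x) with hρ
  have hexp : ∀ x, Real.exp (g x) / Zg * Real.exp (k x) = m⁻¹ * (Real.exp (f x) / Zf) := fun x => by
    simp only [hk, Real.exp_sub, Real.exp_add, Real.exp_log hZf0, Real.exp_log hZg0,
      Real.exp_log hm0]
    have := Real.exp_pos (g x)
    field_simp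
  have hρint : ∀ w : α → ℝ, ∫ x, ρ x * w x ∂Λ.tilted g
      = m⁻¹ * ∫ x in P, w x ∂Λ.tilted f := fun w => by
    rw [← integral_indicator hP, integral_tilted, integral_tilted, ← integral_const_mul]
    congr 1
    ext x
    by_cases hx : x ∈ P
    · simp only [hρ, Set.indicator_of_mem hx, smul_eq_mul]
      rw [← mul_assoc, hexp, mul_assoc]
    · simp [hρ, hx]
  refine ⟨ρ, hkm.exp.indicator hP, fun x => Set.indicator_nonneg (fun _ _ => (Real.exp_pos _).le) x,
    ?_, ?_, ?_⟩
  · have := hρint fun _ => 1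
    simp only [mul_one] at this
    rw [this]
    simp [← hm, hm0.ne']
  · have := hg.isProbabilityMeasure_tilted (Λ := Λ)
    refine Measure.ext fun s hs => ?_
    have h := hρint (s.indicator fun _ => 1)
    have e : (fun x => ρ x * s.indicator (fun _ => 1) x) = s.indicator ρ := by
      ext x
      by_cases hx : x ∈ s <;> simp [hx]
    rw [e, integral_indicator hs, setIntegral_indicator hs] at h
    rw [cond_apply hP, withDensity_apply _ hs, ← ofReal_integral_eq_lintegral_ofReal
      ((hkm.exp.indicator hP).integrable _)
      (Filter.Eventually.of_forall fun x =>
        Set.indicator_nonneg (fun _ _ => (Real.exp_pos _).le) x),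
      h, ENNReal.ofReal_mul (inv_pos.2 hm0).le, ENNReal.ofReal_inv_of_pos hm0]
    simp [hm]
  · have hlog : ∀ x, ρ x * Real.log (ρ x) = ρ x * k x := fun x => by
      by_cases hx : x ∈ P <;> simp [hρ, hx]
    simp only [hlog]
    rw [hρint, mul_inv_cancel_left₀ hm0.ne', hk,
      integral_sub ((h1.add h2).integrable _) (integrable_const _),
      integral_add (h1.integrable _) (h2.integrable _)]
    simp [← hm, Real.negMulLog, sub_eq_add_neg]

end Divergence

section ProductTilted

variable {ι : Type*} [Fintype ι] {X : ι → Type*} [∀ i, MeasurableSpace (X i)]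
  {μ : ∀ i, Measure (X i)} [∀ i, IsProbabilityMeasure (μ i)]

lemma integral_exp_sum (h : ∀ i, X i → ℝ) :
    ∫ x, Real.exp (∑ i, h i (x i)) ∂Measure.pi μ = ∏ i, ∫ y, Real.exp (h i y) ∂μ i := by
  simp only [Real.exp_sum]
  exact integral_fintype_prod_eq_prod fun i y => Real.exp (h i y)

/-- The Gibbs measure of an additively separable function is a product measure. -/
lemma tilted_pi_sum {h : ∀ i, X i → ℝ} (hh : ∀ i, BddMeasurable (h i)) :
    (Measure.pi μ).tilted (fun x => ∑ i, h i (x i)) = Measure.pi fun i => (μ i).tilted (h i) := by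
  have := fun i => (hh i).isProbabilityMeasure_tilted (Λ := μ i)
  refine (Measure.pi_eq fun s hs => ?_).symm
  rw [tilted_apply_eq_ofReal_integral' _ (MeasurableSet.univ_pi hs), Measure.restrict_pi_pi,
    integral_exp_sum]
  simp only [Real.exp_sum, ← Finset.prod_div_distrib]
  rw [integral_fintype_prod_eq_prod (fun i y => Real.exp (h i y) / ∫ y, Real.exp (h i y) ∂μ i),
    ENNReal.ofReal_prod_of_nonneg]
  · exact Finset.prod_congr rfl fun i _ => (tilted_apply_eq_ofReal_integral' _ (hs i)).symm
  · exact fun i _ => integral_nonneg fun y =>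
      div_nonneg (Real.exp_pos _).le (integral_exp_pos ((hh i).exp.integrable _)).le

end ProductTilted

/-! ### Measurable partitions from coverings -/

section Partition

variable {α : Type*} [TopologicalSpace α] [MeasurableSpace α] [OpensMeasurableSpace α]

/-- A finite bound on the covering number is realized by an indexed finite covering. -/
lemma exists_finite_cover {E : Type*} [PseudoMetricSpace E] {r : ℝ} {A : Set E} {M : ℝ}
    (h : (covNumber r A : ℝ≥0∞) ≤ ENNReal.ofReal M) :
    ∃ (k : ℕ) (S : Fin k → Set E), A ⊆ ⋃ j, S j ∧
      (∀ j, Metric.ediam (S j) < ENNReal.ofReal r) ∧ (k : ℝ≥0∞) ≤ ENNReal.ofReal M := by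
  obtain ⟨C, hC⟩ := ENat.exists_eq_iInf fun C : Set (Set E) =>
    ⨅ (_ : A ⊆ ⋃₀ C) (_ : ∀ S ∈ C, Metric.ediam S < ENNReal.ofReal r), C.encard
  have hlt : covNumber r A ≠ ⊤ := fun htop => by simp [htop] at h
  rw [covNumber, ← hC] at hlt h
  by_cases h1 : A ⊆ ⋃₀ C
  · by_cases h2 : ∀ S ∈ C, Metric.ediam S < ENNReal.ofReal r
    · rw [iInf_pos h1, iInf_pos h2] at hlt h
      have hfin : C.Finite := Set.encard_ne_top_iff.1 hlt
      have := hfin.fintype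
      let e := Fintype.equivFin C
      refine ⟨Fintype.card C, fun j => (e.symm j : Set E), ?_, fun j => h2 _ (e.symm j).2, ?_⟩
      · intro a ha
        obtain ⟨S, hS, haS⟩ := h1 ha
        exact Set.mem_iUnion.2 ⟨e ⟨S, hS⟩, by simpa using haS⟩
      · refine le_trans (le_of_eq ?_) h
        rw [Set.encard_eq_coe_toFinset_card, Set.toFinset_card, ENat.toENNReal_coe]
    · exact absurd (by simp [h2]) hlt
  · exact absurd (by simp [h1]) hlt

/-- If the functions `h x` are covered by sets of uniform diameter less than `r`, then the space of
the indices `x` has a measurable partition, no larger than the covering, such that the functions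
indexed by one part are uniformly close. The preimages of the covering sets need not be
measurable, but replacing them by their closures does not affect the uniform bound, since `h x y`
is continuous in `x` for each `y`. -/
lemma exists_measurable_partition [Nonempty α] {β : Type*} [TopologicalSpace β]
    (h : α → β →ᵇ ℝ) (hcont : ∀ y, Continuous fun x => h x y) {r M : ℝ}
    (hcov : (covNumber r (Set.range h) : ℝ≥0∞) ≤ ENNReal.ofReal M) :
    ∃ (parts : Finset (Set α)) (D : ℝ), Setoid.IsPartition (parts : Set (Set α)) ∧
      (∀ P ∈ parts, MeasurableSet P) ∧ (parts.card : ℝ) ≤ M ∧ D < r ∧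
      ∀ P ∈ parts, ∀ x ∈ P, ∀ x' ∈ P, ∀ y, |h x y - h x' y| ≤ D := by
  classical
  obtain ⟨k, S, hS, hdiam, hk⟩ := exists_finite_cover hcov
  obtain ⟨x₀⟩ := ‹Nonempty α›
  obtain ⟨j₀, -⟩ := Set.mem_iUnion.1 (hS (Set.mem_range_self x₀))
  have hr : 0 < ENNReal.ofReal r := lt_of_le_of_lt bot_le (hdiam j₀)
  set d : ℝ≥0∞ := Finset.univ.sup fun j => Metric.ediam (S j) with hd
  have hdr : d < ENNReal.ofReal r := (Finset.sup_lt_iff hr).2 fun j _ => hdiam j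
  set A : Fin k → Set α := fun j => closure (h ⁻¹' S j) with hA
  have hAd : ∀ j, ∀ x ∈ A j, ∀ x' ∈ A j, ∀ y, |h x y - h x' y| ≤ d.toReal := by
    intro j x hx x' hx' y
    have hcl : IsClosed {p : α × α | |h p.1 y - h p.2 y| ≤ d.toReal} :=
      isClosed_le (((hcont y).comp continuous_fst).sub ((hcont y).comp continuous_snd)).abs
        continuous_const
    have hsub : (h ⁻¹' S j) ×ˢ (h ⁻¹' S j) ⊆ {p : α × α | |h p.1 y - h p.2 y| ≤ d.toReal} := by
      rintro ⟨a, b⟩ ⟨ha, hb⟩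
      have h1 : edist (h a) (h b) ≤ d :=
        (Metric.edist_le_ediam_of_mem (s := S j) ha hb).trans
          (Finset.le_sup (f := fun j => Metric.ediam (S j)) (Finset.mem_univ j))
      have h2 : dist (h a) (h b) ≤ d.toReal := by
        rw [dist_edist]
        exact ENNReal.toReal_mono hdr.ne_top h1
      exact (Real.dist_eq _ _ ▸ BoundedContinuousFunction.dist_coe_le_dist y).trans h2
    have := closure_minimal hsub hcl
    rw [closure_prod_eq] at this
    exact this (Set.mk_mem_prod hx hx')
  have hcover : ∀ x, ∃ j, x ∈ disjointed A j := fun x => by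
    obtain ⟨j, hj⟩ := Set.mem_iUnion.1 (hS (Set.mem_range_self x))
    have : x ∈ ⋃ j, disjointed A j := by
      rw [iUnion_disjointed]
      exact Set.mem_iUnion.2 ⟨j, subset_closure hj⟩
    exact Set.mem_iUnion.1 this
  refine ⟨(Finset.univ.image (disjointed A)).filter Set.Nonempty, d.toReal, ⟨by simp, ?_⟩,
    ?_, ?_, ENNReal.toReal_lt_of_lt_ofReal hdr, ?_⟩
  · intro x
    obtain ⟨j, hj⟩ := hcover x
    refine ⟨disjointed A j, ⟨by simpa using ⟨x, hj⟩, hj⟩, ?_⟩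
    rintro P ⟨hP, hxP⟩
    simp only [Finset.coe_filter, Finset.mem_image, Finset.mem_univ, true_and,
      Set.mem_ofPred_eq] at hP
    obtain ⟨⟨i, rfl⟩, -⟩ := hP
    by_contra hne
    have hij : i ≠ j := fun e => hne (by rw [e])
    exact Set.disjoint_left.1 (disjoint_disjointed A hij) hxP hj
  · intro P hP
    simp only [Finset.mem_filter, Finset.mem_image, Finset.mem_univ, true_and] at hP
    obtain ⟨⟨i, rfl⟩, -⟩ := hP
    exact disjointedRec (p := MeasurableSet)
      (fun _ _ ht => ht.diff isClosed_closure.measurableSet) isClosed_closure.measurableSet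
  · have h1 : ((Finset.univ.image (disjointed A)).filter Set.Nonempty).card ≤ k :=
      (Finset.card_filter_le _ _).trans (Finset.card_image_le.trans (by simp))
    have h2 : ((k : ℝ≥0∞)).toReal ≤ M := by
      rcases le_or_gt 0 M with hM | hM
      · exact ENNReal.toReal_le_of_le_ofReal hM hk
      · rw [ENNReal.ofReal_of_nonpos hM.le] at hk
        have : k = 0 := by simpa using hk
        exact absurd j₀.2 (by omega)
    exact (Nat.cast_le.2 h1).trans (by simpa using h2)
  · intro P hP x hx x' hx' y
    simp only [Finset.mem_filter, Finset.mem_image, Finset.mem_univ, true_and] at hP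
    obtain ⟨⟨i, rfl⟩, -⟩ := hP
    exact hAd i x (disjointed_subset A i hx) x' (disjointed_subset A i hx') y

end Partition

/-! ### Gibbs measures and discrete gradients -/

/-- A probability vector on `N` points has entropy at most `log N`. -/
lemma sum_negMulLog_le_log_card {α : Type*} {s : Finset α} {m : α → ℝ} (h0 : ∀ a ∈ s, 0 ≤ m a)
    (h1 : ∑ a ∈ s, m a = 1) : ∑ a ∈ s, Real.negMulLog (m a) ≤ Real.log s.card := by
  have hs : s.Nonempty := by
    by_contra h
    simp [Finset.not_nonempty_iff_eq_empty.1 h] at h1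
  have hN : (0 : ℝ) < s.card := Nat.cast_pos.2 hs.card_pos
  have key : ∀ a ∈ s, Real.negMulLog (m a) ≤ m a * Real.log s.card + (s.card : ℝ)⁻¹ - m a := by
    intro a ha
    rcases (h0 a ha).eq_or_lt with h | h
    · rw [← h]
      simp
    · have hl := Real.log_le_sub_one_of_pos (x := (m a * s.card)⁻¹) (by positivity)
      rw [Real.log_inv, Real.log_mul h.ne' hN.ne'] at hl
      have := mul_le_mul_of_nonneg_left hl h.le
      rw [mul_sub, mul_inv, mul_inv_cancel_left₀ h.ne'] at this
      rw [Real.negMulLog]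
      linarith
  refine (Finset.sum_le_sum key).trans (le_of_eq ?_)
  rw [Finset.sum_sub_distrib, Finset.sum_add_distrib, ← Finset.sum_mul, h1, Finset.sum_const,
    nsmul_eq_mul, mul_inv_cancel₀ hN.ne']
  ring

lemma sum_setIntegral_of_isPartition {α : Type*} [MeasurableSpace α] {m : Measure α}
    {parts : Finset (Set α)} (hpart : Setoid.IsPartition (parts : Set (Set α)))
    (hmeas : ∀ P ∈ parts, MeasurableSet P) {w : α → ℝ} (hw : Integrable w m) :
    ∑ P ∈ parts, ∫ x in P, w x ∂m = ∫ x, w x ∂m := by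
  rw [← integral_biUnion_finset (s := fun P : Set α => P) parts hmeas hpart.pairwiseDisjoint
    fun P _ => hw.integrableOn]
  have : ⋃ P ∈ parts, P = Set.univ := by
    rw [← hpart.sUnion_eq_univ, Set.sUnion_eq_biUnion]
    rfl
  rw [this, Measure.restrict_univ]

lemma bddMeasurable_coe {α : Type*} [TopologicalSpace α] [MeasurableSpace α]
    [OpensMeasurableSpace α] (f : α →ᵇ ℝ) : BddMeasurable f :=
  ⟨f.continuous.measurable, ‖f‖, f.norm_coe_le_norm⟩

lemma exp_neg_norm_le {α : Type*} [TopologicalSpace α] (f : α →ᵇ ℝ) (x : α) :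
    Real.exp (-‖f‖) ≤ Real.exp (f x) :=
  Real.exp_le_exp.2 (neg_le_of_abs_le (f.norm_coe_le_norm x))

section Gradient

variable {n : ℕ} {K : Fin n → Type*} [∀ i, TopologicalSpace (K i)]

lemma discreteGradient_self (f : (∀ i, K i) →ᵇ ℝ) (star x : ∀ i, K i) :
    discreteGradient f star x x = ∑ i, (f x - f (Function.update x i (star i))) := by
  change ∑ i, partialDiff f star i x (x i) = _
  simp [partialDiff]

lemma continuous_discreteGradient (f : (∀ i, K i) →ᵇ ℝ) (star y : ∀ i, K i) :
    Continuous fun x => discreteGradient f star x y := by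
  change Continuous fun x => ∑ i, partialDiff f star i x (y i)
  refine continuous_finsetSum _ fun i _ => ?_
  exact (f.continuous.comp (continuous_id.update i continuous_const)).sub
    (f.continuous.comp (continuous_id.update i continuous_const))

lemma additivelySeparable_discreteGradient (f : (∀ i, K i) →ᵇ ℝ) (star x : ∀ i, K i) :
    AdditivelySeparable (discreteGradient f star x) := by
  refine ⟨fun i => BoundedContinuousFunction.ofNormedAddCommGroup (partialDiff f star i x)
    ((f.continuous.comp (continuous_const.update i continuous_id)).sub continuous_const)
    (‖f‖ + ‖f‖) fun y => (norm_sub_le _ _).trans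
      (add_le_add (f.norm_coe_le_norm _) (f.norm_coe_le_norm _)), fun y => rfl⟩

end Gradient

section Gibbs

variable {n : ℕ} {K : Fin n → Type*} [∀ i, MetricSpace (K i)]
  [∀ i, SecondCountableTopology (K i)] [∀ i, MeasurableSpace (K i)] [∀ i, BorelSpace (K i)]
  {lam : ∀ i, Measure (K i)} [∀ i, IsProbabilityMeasure (lam i)]

lemma bddMeasurable_partialDiff (f : (∀ i, K i) →ᵇ ℝ) (star x : ∀ i, K i) (i : Fin n) :
    BddMeasurable (partialDiff f star i x) :=
  ((bddMeasurable_coe f).comp (measurable_update x)).sub (.const _)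

/-- The Gibbs measure of `∇f(x, ·)` is the product of the conditional laws of the coordinates under
the Gibbs measure of `f`, each given that the other coordinates agree with those of `x`. Here this
is the corresponding statement for logarithms of normalizing constants. -/
lemma log_integral_exp_discreteGradient (f : (∀ i, K i) →ᵇ ℝ) (star x : ∀ i, K i) :
    Real.log (∫ y, Real.exp (discreteGradient f star x y) ∂Measure.pi lam)
      = ∑ i, (Real.log (coordAvg lam i (fun x => Real.exp (f x)) x)
        - f (Function.update x i (star i))) := by
  have h : ∀ i, ∫ y, Real.exp (partialDiff f star i x y) ∂lam i
      = coordAvg lam i (fun x => Real.exp (f x)) x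
        / Real.exp (f (Function.update x i (star i))) := fun i => by
    simp only [partialDiff, Real.exp_sub]
    exact integral_div _ _
  have hpos : ∀ i, 0 < coordAvg lam i (fun x => Real.exp (f x)) x := fun i =>
    (Real.exp_pos _).trans_le (le_coordAvg (bddMeasurable_coe f).exp (exp_neg_norm_le f) x)
  change Real.log (∫ y, Real.exp (∑ i, partialDiff f star i x (y i)) ∂Measure.pi lam) = _
  rw [integral_exp_sum, Real.log_prod fun i _ => ?_]
  · refine Finset.sum_congr rfl fun i _ => ?_
    rw [h, Real.log_div (hpos i).ne' (Real.exp_pos _).ne', Real.log_exp]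
  · rw [h]
    exact (div_pos (hpos i) (Real.exp_pos _)).ne'

lemma bddMeasurable_log_coordAvg (f : (∀ i, K i) →ᵇ ℝ) (i : Fin n) :
    BddMeasurable fun x => Real.log (coordAvg lam i (fun x => Real.exp (f x)) x) :=
  ((bddMeasurable_coe f).exp.coordAvg i).log (Real.exp_pos _)
    (le_coordAvg (bddMeasurable_coe f).exp (exp_neg_norm_le f))

lemma bddMeasurable_update_star (f : (∀ i, K i) →ᵇ ℝ) (star : ∀ i, K i) (i : Fin n) :
    BddMeasurable fun x => f (Function.update x i (star i)) :=
  (bddMeasurable_coe f).comp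
    (measurable_update'.comp (measurable_id.prodMk measurable_const))

lemma bddMeasurable_log_integral_exp (f : (∀ i, K i) →ᵇ ℝ) (star : ∀ i, K i) :
    BddMeasurable fun x =>
      Real.log (∫ y, Real.exp (discreteGradient f star x y) ∂Measure.pi lam) := by
  simp only [log_integral_exp_discreteGradient]
  exact .sum _ fun i _ => (bddMeasurable_log_coordAvg f i).sub (bddMeasurable_update_star f star i)

lemma bddMeasurable_discreteGradient_self (f : (∀ i, K i) →ᵇ ℝ) (star : ∀ i, K i) :
    BddMeasurable fun x => discreteGradient f star x x := by
  simp only [discreteGradient_self]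
  exact .sum _ fun i _ => (bddMeasurable_coe f).sub (bddMeasurable_update_star f star i)

/-- Subadditivity of entropy for a Gibbs measure. The left-hand side is its divergence from the
reference measure, and the right-hand side is the sum of its conditional divergences, written in
terms of the discrete gradient. -/
lemma integral_gibbs_le (f : (∀ i, K i) →ᵇ ℝ) (star : ∀ i, K i) :
    ∫ x, (f x - Real.log (∫ y, Real.exp (f y) ∂Measure.pi lam)) ∂gibbs lam f
      ≤ ∫ x, (discreteGradient f star x x
        - Real.log (∫ y, Real.exp (discreteGradient f star x y) ∂Measure.pi lam))
          ∂gibbs lam f := by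
  have hf := bddMeasurable_coe f
  have h := integral_mul_log_le_sum (μ := lam) hf.exp (Real.exp_pos _) (exp_neg_norm_le f)
  simp only [Real.log_exp] at h
  have hZ : 0 < ∫ y, Real.exp (f y) ∂Measure.pi lam := integral_exp_pos (hf.exp.integrable _)
  rw [gibbs, integral_tilted, integral_tilted]
  simp only [smul_eq_mul, div_mul_eq_mul_div]
  rw [integral_div, integral_div]
  refine div_le_div_of_nonneg_right (h.trans (le_of_eq ?_)) hZ.le
  rw [← integral_finsetSum _ fun i _ =>
    (hf.exp.mul (hf.sub (bddMeasurable_log_coordAvg f i))).integrable _]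
  congr 1
  ext x
  rw [discreteGradient_self, log_integral_exp_discreteGradient, ← Finset.sum_sub_distrib,
    Finset.mul_sum]
  refine Finset.sum_congr rfl fun i _ => ?_
  ring

/-- The transportation inequality on one part: `transportDist` is normalized by `1 / n`. -/
lemma transportDist_le (hn : n ≠ 0) (hdiam : ∀ i, ∀ x y : K i, dist x y ≤ 1)
    {ρ : (∀ i, K i) → ℝ} (hρ : BddMeasurable ρ) (hρ0 : ∀ x, 0 ≤ ρ x)
    (hρ1 : ∫ x, ρ x ∂Measure.pi lam = 1) :
    transportDist ((Measure.pi lam).withDensity fun x => ENNReal.ofReal (ρ x)) (Measure.pi lam)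
      ≤ ENNReal.ofReal (Real.sqrt ((∫ x, ρ x * Real.log (ρ x) ∂Measure.pi lam) / (2 * n))) := by
  have : Nonempty (Fin n) := ⟨⟨0, Nat.pos_of_ne_zero hn⟩⟩
  have hn0 : (0 : ℝ) < n := Nat.cast_pos.2 (Nat.pos_of_ne_zero hn)
  have hcm : Measurable fun p : (∀ i, K i) × (∀ i, K i) =>
      ENNReal.ofReal (∑ i, dist (p.1 i) (p.2 i)) :=
    (Finset.measurable_sum _ fun i _ => ((measurable_pi_apply i).comp measurable_fst).dist
      ((measurable_pi_apply i).comp measurable_snd)).ennreal_ofReal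
  obtain ⟨π, h1, h2, h3⟩ := exists_coupling_le_sqrt (μ := lam) hρ hρ0 hρ1 hcm (fun x => by simp)
    (fun i x z y => by
      rw [← ENNReal.ofReal_one, ← ENNReal.ofReal_add (Finset.sum_nonneg fun _ _ => dist_nonneg)
        zero_le_one]
      refine ENNReal.ofReal_le_ofReal ?_
      rw [← Finset.sum_erase_add _ _ (Finset.mem_univ i),
        ← Finset.sum_erase_add _ (fun i => dist (x i) (z i)) (Finset.mem_univ i)]
      have e : ∑ j ∈ Finset.univ.erase i, dist (x j) (Function.update z i y j)
          = ∑ j ∈ Finset.univ.erase i, dist (x j) (z j) :=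
        Finset.sum_congr rfl fun j hj => by rw [Function.update_of_ne (Finset.ne_of_mem_erase hj)]
      have h1 := hdiam i (x i) (Function.update z i y i)
      have h2 : 0 ≤ dist (x i) (z i) := dist_nonneg
      dsimp only
      rw [e]
      linarith)
  refine (iInf_le_of_le π (iInf_le_of_le h1 (iInf_le_of_le h2 le_rfl))).trans ?_
  simp only [hammingAvg]
  calc _ = ENNReal.ofReal (1 / n) * ∫⁻ p, ENNReal.ofReal (∑ i, dist (p.1 i) (p.2 i)) ∂π := by
        rw [← lintegral_const_mul _ hcm]
        exact lintegral_congr fun p => ENNReal.ofReal_mul (by positivity)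
    _ ≤ _ := mul_le_mul_right h3 _
    _ = _ := by
        rw [← ENNReal.ofReal_mul (by positivity), Fintype.card_fin]
        congr 1
        rw [← Real.sqrt_sq (show (0 : ℝ) ≤ 1 / n by positivity), ← Real.sqrt_mul (by positivity)]
        congr 1
        field_simp

/-- On a part on which the discrete gradients are within `D` of each other, one of them, at a
point `x₀` where the normalizing constant is at most average, defines a product measure close to
the conditioned Gibbs measure. Here `d` is the divergence between the two, and the last inequality
compares it with the integrand in the subadditivity of entropy. -/
lemma exists_gradient_on_part (hn : n ≠ 0) (hdiam : ∀ i, ∀ x y : K i, dist x y ≤ 1)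
    (star : ∀ i, K i) (f : (∀ i, K i) →ᵇ ℝ) {P : Set (∀ i, K i)} (hP : MeasurableSet P)
    (hPne : P.Nonempty) {D : ℝ}
    (hD : ∀ x ∈ P, ∀ x' ∈ P, ∀ y,
      |discreteGradient f star x y - discreteGradient f star x' y| ≤ D) :
    ∃ x₀ : ∀ i, K i, ∃ d : ℝ, 0 ≤ d ∧
      gibbs lam f P * klDiv (cond (gibbs lam f) P) (gibbs lam (discreteGradient f star x₀))
        = ENNReal.ofReal ((gibbs lam f).real P * d) ∧
      gibbs lam f P * transportDist (cond (gibbs lam f) P)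
          (gibbs lam (discreteGradient f star x₀))
        ≤ ENNReal.ofReal ((gibbs lam f).real P * Real.sqrt (d / (2 * n))) ∧
      (gibbs lam f).real P * d
        ≤ ∫ x in P, (f x - Real.log (∫ y, Real.exp (f y) ∂Measure.pi lam)) ∂gibbs lam f
          - ∫ x in P, (discreteGradient f star x x
            - Real.log (∫ y, Real.exp (discreteGradient f star x y) ∂Measure.pi lam)) ∂gibbs lam f
          + (gibbs lam f).real P * D + Real.negMulLog ((gibbs lam f).real P) := by
  have hf := bddMeasurable_coe f
  have hprob : IsProbabilityMeasure (gibbs lam f) := hf.isProbabilityMeasure_tilted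
  by_cases hP0 : gibbs lam f P = 0
  · -- the factor `0` also absorbs the value `∞` of `transportDist` at the zero measure `cond _ P`
    have hr : (gibbs lam f).real P = 0 := by simp [Measure.real, hP0]
    exact ⟨hPne.some, 0, le_rfl, by simp [hP0], by simp [hP0], by
      simp [hr, Measure.restrict_eq_zero.2 hP0]⟩
  set Z := Real.log (∫ y, Real.exp (f y) ∂Measure.pi lam) with hZ
  set H : (∀ i, K i) → ℝ := fun x =>
    Real.log (∫ y, Real.exp (discreteGradient f star x y) ∂Measure.pi lam) with hH
  have hHm : BddMeasurable H := bddMeasurable_log_integral_exp f star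
  have hGm := bddMeasurable_discreteGradient_self f star
  obtain ⟨x₀, hx₀, hle⟩ := exists_le_setAverage hP0 (measure_ne_top _ _)
    (hHm.integrable (gibbs lam f)).integrableOn
  have hm0 : 0 < (gibbs lam f).real P := ENNReal.toReal_pos hP0 (measure_ne_top _ _)
  have hg := bddMeasurable_coe (discreteGradient f star x₀)
  have hprod : gibbs lam (discreteGradient f star x₀)
      = Measure.pi fun i => (lam i).tilted (partialDiff f star i x₀) :=
    tilted_pi_sum fun i => bddMeasurable_partialDiff f star x₀ i
  have hpr : IsProbabilityMeasure (gibbs lam (discreteGradient f star x₀)) :=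
    hg.isProbabilityMeasure_tilted
  have hprobi := fun i =>
    (bddMeasurable_partialDiff f star x₀ i).isProbabilityMeasure_tilted (Λ := lam i)
  obtain ⟨ρ, hρ, hρ0, hρ1, hcond, hdiv⟩ :=
    exists_density_cond_tilted (Λ := Measure.pi lam) hf hg hP hP0
  change cond (gibbs lam f) P = (gibbs lam (discreteGradient f star x₀)).withDensity _ at hcond
  change ∫ x, ρ x ∂gibbs lam (discreteGradient f star x₀) = 1 at hρ1
  change (gibbs lam f).real P * ∫ x, ρ x * Real.log (ρ x) ∂gibbs lam (discreteGradient f star x₀)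
    = ∫ x in P, (f x - Z) ∂gibbs lam f
      + ∫ x in P, (H x₀ - discreteGradient f star x₀ x) ∂gibbs lam f
      + Real.negMulLog ((gibbs lam f).real P) at hdiv
  refine ⟨x₀, ∫ x, ρ x * Real.log (ρ x) ∂gibbs lam (discreteGradient f star x₀), ?_, ?_, ?_, ?_⟩
  · have h : 0 ≤ ∫ x, (ρ x * Real.log (ρ x) - ρ x + 1)
        ∂gibbs lam (discreteGradient f star x₀) := integral_nonneg fun x => by
      simpa using mul_le_mul_log_sub_add_exp (hρ0 x) 0
    rw [integral_add ((hρ.mul_log.sub hρ).integrable _) (integrable_const _),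
      integral_sub (hρ.mul_log.integrable _) (hρ.integrable _), hρ1] at h
    simpa using h
  · rw [hcond, klDiv_withDensity_ofReal _ hρ hρ0 hρ1, ENNReal.ofReal_mul hm0.le,
      ofReal_measureReal]
  · rw [hcond, ENNReal.ofReal_mul hm0.le, ofReal_measureReal]
    rw [hprod] at hρ1 ⊢
    exact mul_le_mul_right (transportDist_le hn hdiam hρ hρ0 hρ1) _
  · rw [hdiv]
    -- `D` is spent once, on the gradients; the normalizing constants are compared on average only
    have hA : ∫ x in P, (H x₀ - discreteGradient f star x₀ x) ∂gibbs lam f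
        ≤ ∫ x in P, (H x - discreteGradient f star x x + D) ∂gibbs lam f := by
      have e1 : ∫ x in P, (H x₀ - discreteGradient f star x₀ x) ∂gibbs lam f
          ≤ ∫ x in P, (H x₀ - discreteGradient f star x x + D) ∂gibbs lam f := by
        refine setIntegral_mono_on (((BddMeasurable.const _).sub hg).integrable _).integrableOn
          ((((BddMeasurable.const _).sub hGm).add (.const D)).integrable _).integrableOn hP
          fun x hx => ?_
        have := (abs_le.1 (hD x hx x₀ hx₀ x)).2
        linarith
      have e2 : ∫ _ in P, H x₀ ∂gibbs lam f ≤ ∫ x in P, H x ∂gibbs lam f := by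
        rw [setAverage_eq, smul_eq_mul, inv_mul_eq_div, le_div_iff₀ hm0] at hle
        rw [setIntegral_const, smul_eq_mul]
        linarith
      refine e1.trans ?_
      rw [integral_add ((BddMeasurable.sub (.const _) hGm).integrable _) (integrable_const _),
        integral_add ((hHm.sub hGm).integrable _) (integrable_const _),
        integral_sub (integrable_const _) (hGm.integrable _),
        integral_sub (hHm.integrable _) (hGm.integrable _)]
      linarith
    have hB : ∫ x in P, (H x - discreteGradient f star x x + D) ∂gibbs lam f
        = -∫ x in P, (discreteGradient f star x x - H x) ∂gibbs lam f
          + (gibbs lam f).real P * D := by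
      rw [integral_add ((hHm.sub hGm).integrable _) (integrable_const _), ← integral_neg,
        setIntegral_const, smul_eq_mul]
      simp only [neg_sub]
    linarith

end Gibbs

end LowComplexityGibbs

theorem mainTheorem2 {n : ℕ} {K : Fin n → Type*}
    [∀ i, MetricSpace (K i)] [∀ i, CompleteSpace (K i)]
    [∀ i, TopologicalSpace.SeparableSpace (K i)]
    [∀ i, MeasurableSpace (K i)] [∀ i, BorelSpace (K i)]
    (hdiam : ∀ i, ∀ x y : K i, dist x y ≤ 1)
    (star : ∀ i, K i)
    (lam : ∀ i, Measure (K i)) [∀ i, IsProbabilityMeasure (lam i)]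
    (f : (∀ i, K i) →ᵇ ℝ) (ε δ : ℝ)
    (hcov : (LowComplexityGibbs.covNumber (δ * n)
        (Set.range fun x => LowComplexityGibbs.discreteGradient f star x) : ℝ≥0∞)
      ≤ ENNReal.ofReal (Real.exp (ε * n))) :
    ∃ (parts : Finset (Set (∀ i, K i))) (g : Set (∀ i, K i) → (∀ i, K i) → ℝ),
      Setoid.IsPartition (parts : Set (Set (∀ i, K i))) ∧
      (∀ P ∈ parts, MeasurableSet P) ∧
      (parts.card : ℝ) ≤ Real.exp (ε * n) ∧
      (∀ P ∈ parts, LowComplexityGibbs.AdditivelySeparable (g P)) ∧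
      ∑ P ∈ parts, LowComplexityGibbs.gibbs lam f P *
          klDiv (cond (LowComplexityGibbs.gibbs lam f) P) (LowComplexityGibbs.gibbs lam (g P))
        < ENNReal.ofReal ((ε + δ) * n) ∧
      ∑ P ∈ parts, LowComplexityGibbs.gibbs lam f P *
          LowComplexityGibbs.transportDist (cond (LowComplexityGibbs.gibbs lam f) P)
            (LowComplexityGibbs.gibbs lam (g P))
        < ENNReal.ofReal (Real.sqrt ((ε + δ) / 2)) := by
  classical
  open LowComplexityGibbs in
  have hsc : ∀ i, SecondCountableTopology (K i) := fun i =>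
    UniformSpace.secondCountable_of_separable (K i)
  have hne : Nonempty (∀ i, K i) := ⟨star⟩
  obtain ⟨parts, D, hpart, hmeas, hcard, hDlt, hD⟩ :=
    exists_measurable_partition (discreteGradient f star) (continuous_discreteGradient f star) hcov
  have hPne : ∀ P ∈ parts, P.Nonempty := fun P hP =>
    Set.nonempty_iff_ne_empty.2 fun h => hpart.1 (h ▸ Finset.mem_coe.2 hP)
  obtain ⟨P₀, ⟨hP₀, hx₀⟩, -⟩ := hpart.2 star
  have hD0 : 0 ≤ D := (abs_nonneg _).trans (hD P₀ hP₀ star hx₀ star hx₀ star)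
  -- there is no covering by sets of diameter less than `δ * n` unless this is positive
  have hn : n ≠ 0 := by
    rintro rfl
    simp only [Nat.cast_zero, mul_zero] at hDlt
    exact absurd hDlt (not_lt.2 hD0)
  have hn0 : (0 : ℝ) < n := Nat.cast_pos.2 (Nat.pos_of_ne_zero hn)
  have key := fun (P : Set (∀ i, K i)) (hP : P ∈ parts) =>
    exists_gradient_on_part (lam := lam) hn hdiam star f (hmeas P hP) (hPne P hP) (hD P hP)
  choose! x₀ d hd0 hkl htr hle using key
  have hf := bddMeasurable_coe f
  have hprob : IsProbabilityMeasure (gibbs lam f) := hf.isProbabilityMeasure_tilted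
  have hmsum : ∑ P ∈ parts, (gibbs lam f).real P = 1 := by
    have := sum_setIntegral_of_isPartition hpart hmeas (integrable_const (μ := gibbs lam f) (1 : ℝ))
    simpa using this
  have hm0 : ∀ P ∈ parts, 0 ≤ (gibbs lam f).real P := fun _ _ => measureReal_nonneg
  have hT0 : 0 ≤ ∑ P ∈ parts, (gibbs lam f).real P * d P :=
    Finset.sum_nonneg fun P hP => mul_nonneg measureReal_nonneg (hd0 P hP)
  have hT : ∑ P ∈ parts, (gibbs lam f).real P * d P < (ε + δ) * n := by
    have h1 := Finset.sum_le_sum hle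
    rw [Finset.sum_add_distrib, Finset.sum_add_distrib, Finset.sum_sub_distrib, ← Finset.sum_mul,
      hmsum, sum_setIntegral_of_isPartition hpart hmeas ((hf.sub (.const _)).integrable _),
      sum_setIntegral_of_isPartition hpart hmeas (((bddMeasurable_discreteGradient_self f star).sub
        (bddMeasurable_log_integral_exp f star)).integrable _)] at h1
    have h2 := integral_gibbs_le (lam := lam) f star
    have h3 := sum_negMulLog_le_log_card hm0 hmsum
    have h4 : Real.log parts.card ≤ ε * n :=
      (Real.log_le_iff_le_exp (Nat.cast_pos.2 (Finset.card_pos.2 ⟨P₀, hP₀⟩))).2 hcard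
    linarith
  refine ⟨parts, fun P => discreteGradient f star (x₀ P), hpart, hmeas, hcard,
    fun P _ => additivelySeparable_discreteGradient f star _, ?_, ?_⟩
  · rw [Finset.sum_congr rfl hkl, ← ENNReal.ofReal_sum_of_nonneg fun P hP =>
      mul_nonneg measureReal_nonneg (hd0 P hP)]
    exact (ENNReal.ofReal_lt_ofReal_iff_of_nonneg hT0).2 hT
  · refine (Finset.sum_le_sum htr).trans_lt ?_
    rw [← ENNReal.ofReal_sum_of_nonneg fun P hP =>
      mul_nonneg measureReal_nonneg (Real.sqrt_nonneg _)]
    rw [ENNReal.ofReal_lt_ofReal_iff_of_nonneg (Finset.sum_nonneg fun P hP =>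
      mul_nonneg measureReal_nonneg (Real.sqrt_nonneg _))]
    calc _ ≤ Real.sqrt (∑ P ∈ parts, (gibbs lam f).real P * (d P / (2 * n))) := by
          have := Real.strictConcaveOn_sqrt.concaveOn.le_map_sum (t := parts)
            (w := fun P => (gibbs lam f).real P) (p := fun P => d P / (2 * n)) hm0 hmsum
            fun P hP => div_nonneg (hd0 P hP) (by positivity)
          simpa only [smul_eq_mul] using this
      _ < _ := by
          simp only [← mul_div_assoc]
          rw [← Finset.sum_div]
          refine Real.sqrt_lt_sqrt (div_nonneg hT0 (by positivity)) ?_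
          rw [div_lt_div_iff₀ (by positivity) two_pos]
          linarith
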